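/- Let $k$ be a field, $n\ge 0$, $S=k[x_1,\dots,x_n]$ with its $\mathbb Z^n$-grading, $\mathfrak m=(x_1,\dots,x_n)$ and $\omega_S=S(-\mathbf 1)$. For $a\in\mathbb Z^n$ put $\operatorname{supp}_+(a)=\{i: a_i>0\}$, and identify $F\subseteq[n]$ with the $0/1$-vector with support $F$. A $\mathbb Z^n$-graded $S$-module $M$ is *squarefree* if $M_a=0$ for $a\notin\mathbb N^n$, $\dim_k M_a<\infty$ for all $a$, and the multiplication $x^b:M_a\to M_{a+b}$ is bijective for all $a,b\in\mathbb N^n$ with $\operatorname{supp}_+(a+b)=\operatorname{supp}_+(a)$. For graded modules $M,N$ let $\operatorname{Hom}_S(M,N)$ and $\operatorname{Ext}^i_S(M,N)$ be the graded modules whose components in degree $a$ are $\operatorname{Hom}(M,N(a))$ and $\operatorname{Ext}^i(M,N(a))$, taken in the category of $\mathbb Z^n$-graded $S$-modules and degree preserving maps ($\operatorname{Ext}^i=0$ for $i<0$). For $F\subseteq[n]$ let $P_F=(x_i: i\notin F)$, let ${}^*E(S/P_F)$ be the injective envelope of $S/P_F$ in this category, and let $\omega^\bullet$ be the complex with $\omega^{i}=\bigoplus_{|F|=-i}{}^*E(S/P_F)$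 whose differential has the components $(-1)^{\#\{i\in F:\, i<j\}}\cdot\mathrm{nat}:{}^*E(S/P_F)\to{}^*E(S/P_{F\setminus\{j\}})$ for $j\in F$; it is a minimal injective resolution of $\omega_S[n]$. Let $\mathcal N(M)=\bigoplus_{a\in\mathbb N^n}M_a$, and put $\mathbf D(M)=\mathcal N(\operatorname{Hom}^\bullet_S(M,\omega^\bullet))$. Let $\mathbf A$ be the exact contravariant Alexander duality functor: $\mathbf A(M)_a$ is the $k$-dual of $M_{[n]\setminus \operatorname{supp}_+(a)}$ for $a\in\mathbb N^n$ and zero for $a\notin\mathbb N^n$, with multiplications dual to those of $M$; on complexes, $\mathbf A(X^\bullet)^i=\mathbf A(X^{-i})$. Let $M$ be a squarefree $S$-module. Then for all $i\in\mathbb Z$ the module $\operatorname{Ext}^{n-i}_S(M,\omega_S)$ is squarefree, and there is an isomorphism of graded $S$-modules $$H^i(\mathbf A\circ\mathbf D(M))\cong\mathbf A(\operatorname{Ext}^{n-i}_S(M,\omega_S)).$$ Moreover, for every $d\in\mathbb N$, $H^i(\mathbf A\circ\mathbf D(M))=0$ for all $i\ne d$ if and only if $M$ is a Cohen–Macaulay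 module of dimension $d$ (that is, its Krull dimension and its depth with respect to $\mathfrak m$ are both equal to $d$) or $M=0$. -/

import Mathlib

open CategoryTheory

universe u

noncomputable section

namespace SquarefreeMod

/-! ### `ℤⁿ`-graded modules over `S = k[x₁, …, xₙ]` -/

/-- The group `ℤⁿ` of degrees, with its coordinatewise partial order. -/
def Deg (n : ℕ) : Type := Fin n → ℤ

/-- The `i`-th coordinate of a degree. -/
def Deg.coord {n : ℕ} (a : Deg n) (i : Fin n) : ℤ := a i

instance (n : ℕ) : AddCommGroup (Deg n) := inferInstanceAs (AddCommGroup (Fin n → ℤ))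
instance (n : ℕ) : PartialOrder (Deg n) := inferInstanceAs (PartialOrder (Fin n → ℤ))
instance (n : ℕ) : DecidableEq (Deg n) := inferInstanceAs (DecidableEq (Fin n → ℤ))

/-- The category of `ℤⁿ`-graded modules over `S = k[x₁, …, xₙ]` and degree preserving maps.
A graded module `M = ⨁ M_a` is given by its homogeneous components `M_a = M.obj a`, which are
`k`-vector spaces, together with the multiplications by monomials `x^{b - a} : M_a → M_b` for
`a ≤ b`, subject to `x^0 y = y` and `x^c (x^b y) = x^{b + c} y`; that is, by a functor on the
poset `ℤⁿ`.  The underlying `S`-module `⨁ M_a` is `SquarefreeMod.Total M` below. -/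
abbrev GrMod (k : Type u) [Field k] (n : ℕ) : Type (u + 1) := Deg n ⥤ ModuleCat.{u} k

/-- Translation of degrees `a ↦ (b ↦ a + b)`, functorially in `a`. -/
def addDeg (n : ℕ) : Deg n ⥤ Deg n ⥤ Deg n where
  obj a :=
    { obj := fun b => a + b
      map := fun {b c} h => homOfLE (fun i => by
        have := leOfHom h i
        change a i + b i ≤ a i + c i
        lia) }
  map {a a'} h :=
    { app := fun b => homOfLE (fun i => by
        have := leOfHom h i
        change a i + b i ≤ a' i + b i
        lia) }

variable {k : Type u} [Field k] {n : ℕ}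

variable (k n) in
/-- The shifts: `((shift k n).obj N).obj a` is the shifted module `N(a)`, with `N(a)_b = N_{a+b}`.
For `a ≤ a'` the map `N(a) ⟶ N(a')` is the multiplication by `x^{a' - a}`. -/
def shift : GrMod k n ⥤ Deg n ⥤ GrMod k n :=
  (addDeg n ⋙ (Functor.whiskeringLeft _ _ (ModuleCat.{u} k))).flip

/-- The graded Hom module `Hom_S(M, N)`, with `Hom_S(M, N)_a` the space of degree preserving
maps `M ⟶ N(a)`, as a functor in `N`. -/
def grHom (M : GrMod k n) : GrMod k n ⥤ GrMod k n :=
  shift k n ⋙ (Functor.whiskeringRight _ _ _).obj ((linearCoyoneda k (GrMod k n)).obj (.op M))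

/-- The category of graded modules is a Grothendieck abelian category; in particular it has
enough injectives and `Ext` groups. -/
instance : IsGrothendieckAbelian.{u} (GrMod k n) where
  ab5OfSize := ⟨fun _ _ _ => inferInstance⟩
  hasSeparator := by
    have : Limits.HasCoproducts.{0} (ModuleCat.{u} k) :=
      Limits.hasCoproducts_shrink.{0, u}
    exact HasSeparator.of_equivalence
      ((opOpEquivalence (Deg n)).congrLeft (E := ModuleCat.{u} k))

instance : HasExt.{u} (GrMod k n) := IsGrothendieckAbelian.hasExt _

/-- The graded module `Ext^i_S(M, N)` for `i : ℕ`, with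
`Ext^i_S(M, N)_a = Ext^i(M, N(a))` computed in the category of graded modules. -/
def grExt (M N : GrMod k n) (i : ℕ) : GrMod k n where
  obj a := ModuleCat.of k (Abelian.Ext.{u} M (((shift k n).obj N).obj a) i)
  map {a b} h := ModuleCat.ofHom
    (Abelian.Ext.postcompOfLinear (Abelian.Ext.mk₀ (((shift k n).obj N).map h)) k M (add_zero i))
  map_id a := by
    ext x
    simp
  map_comp f g := by
    ext x
    simp [← Abelian.Ext.mk₀_comp_mk₀]

/-- The graded module `Ext^i_S(M, N)` for `i : ℤ`; it is zero for `i < 0`. -/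
def grExtInt (M N : GrMod k n) : ℤ → GrMod k n
  | .ofNat i => grExt M N i
  | .negSucc _ => (Functor.const _).obj (ModuleCat.of k PUnit)

/-! ### The `ℕⁿ`-graded part, the canonical module, squarefree modules -/

/-- The degree `a` component of the `ℕⁿ`-graded part of `M`: all of `M_a` if `0 ≤ a`, and zero
otherwise. -/
def natPartAt (M : GrMod k n) (a : Deg n) : Submodule k (M.obj a) where
  carrier := {x | ¬ 0 ≤ a → x = 0}
  add_mem' hx hy h := by simp [hx h, hy h]
  zero_mem' _ := rfl
  smul_mem' c x hx h := by simp [hx h]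

variable (k n) in
/-- The `ℕⁿ`-graded part `𝒩(M) = ⨁_{a ∈ ℕⁿ} M_a` of a graded module `M`. -/
def natPart : GrMod k n ⥤ GrMod k n where
  obj M :=
    { obj := fun a => ModuleCat.of k (natPartAt M a)
      map := fun {a b} h => ModuleCat.ofHom ((M.map h).hom.restrict fun x hx hb => by
        have hx0 : x = 0 := hx fun ha => hb (ha.trans (leOfHom h))
        simp [hx0])
      map_id := fun a => by
        ext x
        simp
      map_comp := fun f g => by
        ext x
        simp only [M.map_comp]
        rfl }
  map f :=
    { app := fun a => ModuleCat.ofHom ((f.app a).hom.restrict fun x hx ha => by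
        simp [hx ha])
      naturality := fun a b h => by
        ext x
        exact NatTrans.naturality_apply (show _ ⟶ _ from f) h x.1 }
  map_id M := rfl
  map_comp f g := rfl

variable (k n) in
/-- The polynomial ring `S = k[x₁, …, xₙ]` as a graded module over itself: `S_a = k x^a` for
`a ∈ ℕⁿ`, and `S_a = 0` otherwise. -/
def ringS : GrMod k n := (natPart k n).obj ((Functor.const _).obj (ModuleCat.of k k))

variable (k n) in
/-- The graded canonical module `ω_S = S(-𝟏)`. -/
def canonical : GrMod k n := ((shift k n).obj (ringS k n)).obj (fun _ => (-1 : ℤ))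

/-- `supp₊(a) = {i | a_i > 0}`. -/
def posSupp (a : Deg n) : Finset (Fin n) := Finset.univ.filter fun i => 0 < a.coord i

lemma posSupp_mono {a b : Deg n} (h : a ≤ b) : posSupp a ⊆ posSupp b := by
  intro i
  simp only [posSupp, Finset.mem_filter, Finset.mem_univ, true_and]
  exact fun hi => hi.trans_le (h i)

/-- The squarefree degree with support `F`. -/
def sqfreeDeg (F : Finset (Fin n)) : Deg n := fun i => if i ∈ F then (1 : ℤ) else 0

lemma sqfreeDeg_mono {F G : Finset (Fin n)} (h : F ⊆ G) : sqfreeDeg F ≤ sqfreeDeg G := by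
  intro i
  by_cases hF : i ∈ F
  · simp [sqfreeDeg, hF, h hF]
  · simp only [sqfreeDeg, hF, if_false]
    split_ifs
    · exact zero_le_one
    · exact le_rfl

/-- Squarefree modules: `M` is `ℕⁿ`-graded, its components are finite dimensional, and the
multiplication `x^{b - a} : M_a → M_b` is bijective for all `a ≤ b` in `ℕⁿ` with
`supp₊(b) = supp₊(a)`. -/
structure IsSquarefree (M : GrMod k n) : Prop where
  subsingleton : ∀ a : Deg n, ¬ 0 ≤ a → Subsingleton (M.obj a)
  finite : ∀ a : Deg n, 0 ≤ a → Module.Finite k (M.obj a)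
  bijective : ∀ (a b : Deg n) (h : a ≤ b), 0 ≤ a → posSupp b = posSupp a →
    Function.Bijective (M.map (homOfLE h))

/-! ### The Alexander duality functor -/

variable (k n) in
/-- The graded module with component `(M_{F^c})^*`, `F = supp₊(a)`, in *every* degree
`a ∈ ℤⁿ`, and multiplications the `k`-duals of those of `M`. -/
def straightDual : (GrMod k n)ᵒᵖ ⥤ GrMod k n where
  obj M :=
    { obj := fun a => ModuleCat.of k (Module.Dual k (M.unop.obj (sqfreeDeg (posSupp a)ᶜ)))
      map := fun {a b} h => ModuleCat.ofHom (M.unop.map (homOfLE (sqfreeDeg_mono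
        (Finset.compl_subset_compl.mpr (posSupp_mono (leOfHom h)))))).hom.dualMap
      map_id := fun a => by
        ext φ x
        change φ ((M.unop.map (𝟙 _)).hom x) = φ x
        simp
      map_comp := fun {a b c} f g => by
        ext φ x
        change φ _ = φ _
        rw [← ModuleCat.comp_apply, ← Functor.map_comp]
        rfl }
  map f :=
    { app := fun a => ModuleCat.ofHom (f.unop.app (sqfreeDeg (posSupp a)ᶜ)).hom.dualMap
      naturality := fun a b h => by
        ext φ x
        change φ _ = φ _
        rw [← ModuleCat.comp_apply, ← ModuleCat.comp_apply, NatTrans.naturality] }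
  map_id M := rfl
  map_comp f g := rfl

variable (k n) in
/-- The Alexander duality functor `𝐀`: for `a ∈ ℕⁿ` with `F = supp₊(a)`, the component
`𝐀(M)_a = 𝐀(M)_F` is the `k`-dual of `M_{F^c}`, the other components vanish, and the
multiplications are the `k`-duals of the multiplications of `M`. -/
def alexander : (GrMod k n)ᵒᵖ ⥤ GrMod k n := straightDual k n ⋙ natPart k n

/-! ### The dualizing complex and the functors `𝐃` and `𝐀 ∘ 𝐃` -/

/-- The faces `F ⊆ [n]` with `|F| = -p` such that `*E(S/P_F)` is nonzero (hence equal to `k`) in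
degree `a`; the latter means `a_i ≤ 0` for all `i ∉ F`, i.e. `supp₊(a) ⊆ F`. -/
def Face (p : ℤ) (a : Deg n) : Type :=
  {F : Finset (Fin n) // (F.card : ℤ) = -p ∧ posSupp a ⊆ F}

variable (k n) in
/-- The graded module `ω^p = ⨁_{|F| = -p} *E(S/P_F)`.  An element of degree `a` is a family of
scalars indexed by the `F` with `|F| = -p` and `*E(S/P_F)_a = k`; multiplication by `x^{b - a}`
is the identity on the summands which are nonzero in degree `b`. -/
def dualizingObj (p : ℤ) : GrMod k n where
  obj a := ModuleCat.of k (Face p a → k)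
  map h := ModuleCat.ofHom
    (LinearMap.funLeft k k fun F => ⟨F.1, F.2.1, (posSupp_mono (leOfHom h)).trans F.2.2⟩)

/-- The sign `(-1)^{α(j, F)}`, where `α(j, F)` is the number of `i ∈ F` with `i < j`. -/
def sgn (k : Type u) [Field k] (j : Fin n) (F : Finset (Fin n)) : k :=
  (-1) ^ (F.filter (· < j)).card

/-- `G ∪ {j}`, for `j ∉ G`. -/
def Face.insert {p : ℤ} {a : Deg n} (G : Face (p + 1) a) (j : {j // j ∉ G.1}) : Face p a :=
  ⟨Insert.insert j.1 G.1, by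
    have := G.2.1
    rw [Finset.card_insert_of_notMem j.2]
    push_cast
    lia, G.2.2.trans (Finset.subset_insert _ _)⟩

variable (k n) in
/-- The differential `ω^p ⟶ ω^{p+1}` whose component `*E(S/P_F) ⟶ *E(S/P_{F ∖ {j}})` is
`(-1)^{α(j, F)}` times the natural surjection, for `j ∈ F`; below `F = G ∪ {j}`. -/
def dualizingD (p : ℤ) : dualizingObj k n p ⟶ dualizingObj k n (p + 1) where
  app a := ModuleCat.ofHom
    { toFun := fun f G => ∑ j : {j // j ∉ G.1}, sgn k j.1 (G.insert j).1 * f (G.insert j)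
      map_add' := fun f g => by
        funext G
        simp [mul_add, Finset.sum_add_distrib]
      map_smul' := fun c f => by
        funext G
        simp [Finset.mul_sum, mul_left_comm] }
  naturality a b h := by
    ext f
    rfl

lemma dualizingD_comp (p : ℤ) : dualizingD k n p ≫ dualizingD k n (p + 1) = 0 := by
  ext a f
  funext G
  change ∑ j : {j // j ∉ G.1}, sgn k j.1 (G.insert j).1 *
    (∑ l : {l // l ∉ (G.insert j).1}, sgn k l.1 ((G.insert j).insert l).1 *
      f ((G.insert j).insert l)) = 0
  simp only [Finset.mul_sum]
  rw [Finset.sum_sigma']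
  have key : ∀ x : (Σ j : {j // j ∉ G.1}, {l // l ∉ (G.insert j).1}),
      x.2.1 ∉ G.1 ∧ x.1.1 ∉ Insert.insert x.2.1 G.1 ∧ x.1.1 ≠ x.2.1 := by
    rintro ⟨⟨j, hj⟩, ⟨l, hl⟩⟩
    have hl' : l ∉ Insert.insert j G.1 := hl
    simp only [Finset.mem_insert, not_or] at hl' ⊢
    exact ⟨hl'.2, ⟨fun h => hl'.1 h.symm, hj⟩, fun h => hl'.1 h.symm⟩
  refine Finset.sum_involution
    (fun x _ => ⟨⟨x.2.1, (key x).1⟩, ⟨x.1.1, (key x).2.1⟩⟩) ?_ ?_ ?_ ?_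
  · rintro ⟨⟨j, hj⟩, ⟨l, hl⟩⟩ -
    have hne : j ≠ l := (key ⟨⟨j, hj⟩, ⟨l, hl⟩⟩).2.2
    have hlG : l ∉ G.1 := (key ⟨⟨j, hj⟩, ⟨l, hl⟩⟩).1
    have hf : (G.insert ⟨l, hlG⟩).insert ⟨j, (key ⟨⟨j, hj⟩, ⟨l, hl⟩⟩).2.1⟩ =
        (G.insert ⟨j, hj⟩).insert ⟨l, hl⟩ :=
      Subtype.ext (Finset.insert_comm _ _ _)
    dsimp only
    rw [hf, ← mul_assoc, ← mul_assoc, ← add_mul]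
    have hs : sgn k j (Insert.insert j G.1) *
          sgn k l (Insert.insert l (Insert.insert j G.1)) +
        sgn k l (Insert.insert l G.1) *
          sgn k j (Insert.insert l (Insert.insert j G.1)) = 0 := by
      rcases lt_or_gt_of_ne hne with h | h
      · simp [sgn, Finset.filter_insert, h, h.not_gt, hj, pow_succ, mul_comm]
      · simp [sgn, Finset.filter_insert, h, h.not_gt, hlG, pow_succ, mul_comm]
    have : sgn k j (G.insert ⟨j, hj⟩).1 * sgn k l ((G.insert ⟨j, hj⟩).insert ⟨l, hl⟩).1 +
        sgn k l (G.insert ⟨l, hlG⟩).1 * sgn k j ((G.insert ⟨j, hj⟩).insert ⟨l, hl⟩).1 = 0 := hs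
    rw [this, zero_mul]
  · rintro x - - h
    exact (key x).2.2 (congrArg (fun y => y.1.1) h).symm
  · intros
    exact Finset.mem_univ _
  · intros
    rfl

variable (k n) in
/-- The dualizing complex `ω^•` of `S`: the minimal injective resolution of `ω_S[n]` in the
category of graded modules, `0 ⟶ ω^{-n} ⟶ ⋯ ⟶ ω^0 ⟶ 0`. -/
def dualizing : CochainComplex (GrMod k n) ℤ :=
  CochainComplex.of (dualizingObj k n) (dualizingD k n) dualizingD_comp

instance (M : GrMod k n) : (grHom M).PreservesZeroMorphisms where
  map_zero X Y := by
    ext a f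
    change (show M ⟶ _ from f) ≫ _ = 0
    have : ((shift k n).map (0 : X ⟶ Y)).app a = 0 := rfl
    rw [this, Limits.comp_zero]

instance : (natPart k n).PreservesZeroMorphisms where
  map_zero _ _ := rfl

instance : (alexander k n).PreservesZeroMorphisms where
  map_zero _ _ := by
    ext a φ
    apply Subtype.ext
    apply LinearMap.ext
    intro x
    exact LinearMap.map_zero (show Module.Dual k _ from φ.1)

/-- The complex `𝐃(M) = 𝒩(Hom_S^•(M, ω^•))`. -/
def dualD (M : GrMod k n) : CochainComplex (GrMod k n) ℤ :=
  ((grHom M ⋙ natPart k n).mapHomologicalComplex (ComplexShape.up ℤ)).obj (dualizing k n)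

/-- The (contravariant) Alexander duality functor applied to a cochain complex `X`:
`𝐀(X)^i = 𝐀(X^{-i})`. -/
def alexanderComplex (X : CochainComplex (GrMod k n) ℤ) : CochainComplex (GrMod k n) ℤ where
  X i := (alexander k n).obj (.op (X.X (-i)))
  d i j := (alexander k n).map (X.d (-j) (-i)).op
  shape i j h := by
    rw [X.shape, Limits.op_zero, Functor.map_zero]
    simp only [ComplexShape.up_Rel] at h ⊢
    lia
  d_comp_d' i j l _ _ := by
    rw [← Functor.map_comp, ← op_comp, X.d_comp_d, Limits.op_zero, Functor.map_zero]

/-- The complex `ℱ(M) = 𝐀 ∘ 𝐃(M)`. -/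
def complexF (M : GrMod k n) : CochainComplex (GrMod k n) ℤ := alexanderComplex (dualD M)

/-! ### The underlying `S`-module and Cohen–Macaulayness -/

/-- The underlying `S`-module `⨁ M_a` of a graded module. -/
def Total (M : GrMod k n) : Type u := DirectSum (Deg n) fun a => M.obj a

instance (M : GrMod k n) : AddCommGroup (Total M) :=
  inferInstanceAs (AddCommGroup (DirectSum (Deg n) fun a => M.obj a))
instance (M : GrMod k n) : Module k (Total M) :=
  inferInstanceAs (Module k (DirectSum (Deg n) fun a => M.obj a))

/-- The homogeneous element of `⨁ M_a` given by an element of `M_a`. -/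
def Total.of (M : GrMod k n) (a : Deg n) : M.obj a →ₗ[k] Total M :=
  DirectSum.lof k (Deg n) (fun a => M.obj a) a

/-- The degree in `ℤⁿ` of the monomial with exponent vector `m`. -/
def monDeg (m : Fin n →₀ ℕ) : Deg n := fun i => (m i : ℤ)

lemma le_add_monDeg (a : Deg n) (m : Fin n →₀ ℕ) : a ≤ a + monDeg m := fun i => by
  change a i ≤ a i + (m i : ℤ)
  lia

lemma Total.of_map_congr (M : GrMod k n) {a b b' : Deg n} (e : b = b') (h : a ≤ b) (h' : a ≤ b')
    (y : M.obj a) :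
    Total.of M b (M.map (homOfLE h) y) = Total.of M b' (M.map (homOfLE h') y) := by
  subst e
  rfl

/-- Multiplication by the monomial `x^m` on `⨁ M_a`: on `M_a` it is the structure map
`M_a → M_{a + m}`. -/
def monMul (M : GrMod k n) (m : Fin n →₀ ℕ) : Module.End k (Total M) :=
  DirectSum.toModule k (Deg n) (Total M) fun a =>
    Total.of M (a + monDeg m) ∘ₗ (M.map (homOfLE (le_add_monDeg a m))).hom

lemma monMul_of (M : GrMod k n) (m : Fin n →₀ ℕ) (a : Deg n) (y : M.obj a) :
    monMul M m (Total.of M a y) =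
      Total.of M (a + monDeg m) (M.map (homOfLE (le_add_monDeg a m)) y) := by
  unfold monMul Total.of
  exact DirectSum.toModule_lof k (M := fun a => M.obj a) a y

lemma Total.hom_ext {M : GrMod k n} {f g : Module.End k (Total M)}
    (h : ∀ a y, f (Total.of M a y) = g (Total.of M a y)) : f = g :=
  DirectSum.linearMap_ext k fun a => LinearMap.ext fun y => h a y

/-- The action of polynomials on `⨁ M_a`. -/
def polyAct (M : GrMod k n) : MvPolynomial (Fin n) k →ₐ[k] Module.End k (Total M) :=
  AddMonoidAlgebra.lift k (Module.End k (Total M)) (Fin n →₀ ℕ)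
    { toFun := fun m => monMul M m.toAdd
      map_one' := Total.hom_ext fun a y => by
        rw [monMul_of, Module.End.one_apply]
        have e : a + monDeg (0 : Fin n →₀ ℕ) = a := by
          funext i
          exact add_zero (a i)
        refine (Total.of_map_congr M e _ le_rfl y).trans ?_
        have : M.map (homOfLE (le_refl a)) = 𝟙 _ := M.map_id a
        rw [this]
        rfl
      map_mul' := fun m m' => Total.hom_ext fun a y => by
        rw [Module.End.mul_apply, monMul_of, monMul_of, monMul_of, ← ModuleCat.comp_apply,
          ← Functor.map_comp]
        refine Total.of_map_congr M ?_ _ _ y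
        funext i
        change a i + (((m.toAdd i + m'.toAdd i : ℕ)) : ℤ) = a i + (m'.toAdd i : ℤ) + (m.toAdd i : ℤ)
        push_cast
        ring }

instance (M : GrMod k n) : Module (MvPolynomial (Fin n) k) (Total M) :=
  Module.compHom (Total M) (polyAct M).toRingHom

lemma Total.monomial_smul (M : GrMod k n) (m : Fin n →₀ ℕ) (c : k) (a : Deg n) (y : M.obj a) :
    MvPolynomial.monomial m c • Total.of M a y =
      c • Total.of M (a + monDeg m) (M.map (homOfLE (le_add_monDeg a m)) y) := by
  rw [← monMul_of]
  change polyAct M (AddMonoidAlgebra.single m c) _ = _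
  rw [polyAct, AddMonoidAlgebra.lift_single]
  rfl

/-- The supremum of the lengths of the `M`-regular sequences contained in the ideal `I`. -/
def grade {R : Type*} [CommRing R] (I : Ideal R) (M : Type*) [AddCommGroup M] [Module R M] : ℕ∞ :=
  ⨆ rs : {rs : List R // (∀ r ∈ rs, r ∈ I) ∧ RingTheory.Sequence.IsRegular M rs},
    (rs.1.length : ℕ∞)

/-- A finitely generated graded `S`-module is Cohen–Macaulay of dimension `d` if its Krull
dimension and its depth (with respect to the graded maximal ideal `𝔪 = (x₁, …, xₙ)`) are both
equal to `d`. -/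
def IsCohenMacaulayOfDim (M : GrMod k n) (d : ℕ) : Prop :=
  Module.supportDim (MvPolynomial (Fin n) k) (Total M) = d ∧
    grade (Ideal.span (Set.range (MvPolynomial.X : Fin n → MvPolynomial (Fin n) k))) (Total M) = d

end SquarefreeMod

end

open SquarefreeMod

noncomputable section

namespace SquarefreeMod

/-! ### Signs -/

variable {n : ℕ}

/-! Both halves of the theorem rest on one description of `Hom(M, ω^•)`. A map from a graded module
to a shift of `*E(S/P_F)` is a compatible family of functionals, that is, a functional on a directed
colimit of components. For squarefree `M` that colimit is attained at a single component `M_c`,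
where `c` is any "corner" (`IsCorner`). All corners needed in degree `a` can be taken of the form
`a⁻ + F` with `F ⊇ supp₊(a)`, where `a⁻` is the negative part of `a`. Thus `Hom(M, ω^•)_a` is the
`k`-dual of the part of a `ℤⁿ`-graded strand of the Koszul complex of `M` indexed by the sets
containing `supp₊(a)` (`homExact_iff`).

For `Ext`, the shifted terms of `ω^•` are injective, because directed colimits and `k`-duals are
exact, and `ω^•` is exact except at `-n`, where the kernel is `ω_S`. Hence `H^{-i} Hom(M, ω^•)` is
`Ext^{n-i}(M, ω_S)`, compatibly with multiplication (`homologyHomComplexIso`). For `a ≥ 0` the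
corners depend only on `F`, so the multiplications `x^{b-a}` with `supp₊(b) = supp₊(a)` are
bijective already on the terms. If some `a_j < 0`, the strand is contractible (`strandExact_of_pos`)
and the cohomology vanishes. So the cohomology is squarefree, `𝒩` does not change it, and the exact
functor `𝐀` carries it to `H^i(𝐀 ∘ 𝐃(M))`.

For the Cohen–Macaulay criterion, the duality shows that `H^i(𝐀 ∘ 𝐃(M)) = 0` if and only if for
every `A` the complex formed by the `M_F` with `F ⊇ A` is exact at position `i`. On the other side,
there is a weakly regular sequence of length `r` in `𝔪` if and only if Koszul cohomology vanishes
below `r`, that is, all strands with `A = ∅` and arbitrary degree are exact below `r`. The two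
families of conditions are exchanged by long exact sequences that trade an element `j ∈ A` for a
shift of the degree by `-e_j` (`strandExact_iff_localized`). Finally `dim M` is the largest `|F|`
with `M_F ≠ 0`; above it the strands vanish, and at it exactness fails (`not_strandExact`). -/

/-- The sign `(-1)^{α(j, F)}` as an integer. -/
def isgn (j : Fin n) (F : Finset (Fin n)) : ℤ := (-1) ^ (F.filter (· < j)).card

lemma isgn_mul_self (j : Fin n) (F : Finset (Fin n)) : isgn j F * isgn j F = 1 := by
  rw [isgn, ← mul_pow]; simp

lemma isgn_insert_self (j : Fin n) (F : Finset (Fin n)) : isgn j (insert j F) = isgn j F := by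
  simp [isgn, Finset.filter_insert]

lemma isgn_erase_self (j : Fin n) (F : Finset (Fin n)) : isgn j (F.erase j) = isgn j F := by
  simp [isgn, Finset.filter_erase]

lemma isgn_insert_of_lt {j l : Fin n} (h : l < j) {F : Finset (Fin n)} (hl : l ∉ F) :
    isgn j (insert l F) = - isgn j F := by
  simp [isgn, Finset.filter_insert, h, hl, pow_succ]

lemma isgn_insert_of_gt {j l : Fin n} (h : j < l) (F : Finset (Fin n)) :
    isgn j (insert l F) = isgn j F := by
  simp [isgn, Finset.filter_insert, h.not_gt]

lemma isgn_insert_mul {j l : Fin n} (hne : j ≠ l) {F : Finset (Fin n)} (hj : j ∉ F)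
    (hl : l ∉ F) :
    isgn j (insert l F) * isgn l F = - (isgn l (insert j F) * isgn j F) := by
  rcases lt_or_gt_of_ne hne with h | h
  · rw [isgn_insert_of_gt h, isgn_insert_of_lt h hj]; ring
  · rw [isgn_insert_of_gt h, isgn_insert_of_lt h hl]; ring

/-- The two orders of removing `j` and `l` carry opposite signs; this is the reason for `d² = 0` in
the Koszul complex. -/
lemma isgn_erase_mul {j l : Fin n} (hne : j ≠ l) {F : Finset (Fin n)} (hj : j ∈ F)
    (hl : l ∈ F) :
    isgn j F * isgn l (F.erase j) = - (isgn l F * isgn j (F.erase l)) := by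
  have h := isgn_insert_mul hne (F := (F.erase j).erase l) (by simp) (by simp)
  rw [Finset.insert_erase (Finset.mem_erase.2 ⟨hne.symm, hl⟩), Finset.erase_right_comm,
    Finset.insert_erase (Finset.mem_erase.2 ⟨hne, hj⟩), isgn_erase_self, isgn_erase_self] at h
  have h1 := isgn_erase_self l (F.erase j)
  have h2 := isgn_erase_self j (F.erase l)
  rw [Finset.erase_right_comm] at h1
  rw [h1, isgn_erase_self] at h
  have h3 : isgn j (F.erase l) = isgn j ((F.erase l).erase j) := h2.symm
  linarith [mul_comm (isgn j F) (isgn l (F.erase j)), mul_comm (isgn l F) (isgn j (F.erase l))]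

/-- The cancellation of mixed terms in every contracting homotopy below: inserting `j` anticommutes
with removing `l`. -/
lemma isgn_insert_mul_add {j l : Fin n} {F : Finset (Fin n)} (hj : j ∉ F) (hl : l ∈ F) :
    isgn j F * isgn l (insert j F) + isgn l F * isgn j (F.erase l) = 0 := by
  have hjl : j ≠ l := fun h => hj (h ▸ hl)
  have h1 := isgn_erase_mul hjl (F := insert j F) (by simp) (by simp [hl])
  rw [isgn_insert_self, Finset.erase_insert hj, Finset.erase_insert_of_ne hjl,
    isgn_insert_self] at h1
  have h4 : isgn l F * isgn l F = 1 := isgn_mul_self l F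
  have h5 : isgn l (insert j F) * isgn l (insert j F) = 1 := isgn_mul_self l _
  linear_combination (isgn l F * isgn l (insert j F)) * h1 +
    (-isgn j F * isgn l (insert j F)) * h4 + (-isgn l F * isgn j (F.erase l)) * h5

/-! ### The Koszul complex of a module and regular sequences -/

section Koszul

variable {R : Type*} [CommRing R] (x : Fin n → R) {N : Type*} [AddCommGroup N] [Module R N]

variable (N) in
/-- The differential of the Koszul cochain complex of `x` with coefficients in `N`, on families
indexed by all subsets of `Fin n`. -/
def koszulD : (Finset (Fin n) → N) →ₗ[R] (Finset (Fin n) → N) where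
  toFun z F := ∑ l ∈ F, isgn l F • x l • z (F.erase l)
  map_add' z w := by
    funext F
    simp [smul_add, Finset.sum_add_distrib]
  map_smul' c z := by
    funext F
    simp only [Pi.smul_apply, RingHom.id_apply, Finset.smul_sum]
    refine Finset.sum_congr rfl fun l _ => ?_
    rw [smul_comm (x l) c, smul_comm (isgn l F) c]

lemma koszulD_apply (z : Finset (Fin n) → N) (F : Finset (Fin n)) :
    koszulD x N z F = ∑ l ∈ F, isgn l F • x l • z (F.erase l) := rfl

lemma koszulD_comp (z : Finset (Fin n) → N) : koszulD x N (koszulD x N z) = 0 := by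
  funext F
  simp only [koszulD_apply, Finset.smul_sum, Pi.zero_apply]
  rw [Finset.sum_sigma']
  refine Finset.sum_involution (fun p _ => ⟨p.2, p.1⟩) ?_ ?_ ?_ ?_
  · rintro ⟨j, l⟩ h
    simp only [Finset.mem_sigma, Finset.mem_erase] at h
    obtain ⟨hj, hlj, hl⟩ := h
    dsimp only
    rw [Finset.erase_right_comm, smul_comm (x j) (isgn l _), smul_comm (x l) (isgn j _),
      smul_comm (x l) (x j), smul_smul (isgn j F), smul_smul (isgn l F), ← add_smul,
      isgn_erase_mul (Ne.symm hlj) hj hl, neg_add_cancel, zero_smul]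
  · rintro ⟨j, l⟩ h _ he
    simp only [Finset.mem_sigma, Finset.mem_erase] at h
    exact h.2.1 (congrArg Sigma.fst he)
  · rintro ⟨j, l⟩ h
    simp only [Finset.mem_sigma, Finset.mem_erase] at h ⊢
    exact ⟨h.2.2, Ne.symm h.2.1, h.1⟩
  · intros; rfl

variable (R N) in
/-- The contraction of the Koszul complex along the `j`-th basis vector. -/
def koszulContract (j : Fin n) : (Finset (Fin n) → N) →ₗ[R] (Finset (Fin n) → N) where
  toFun z F := if j ∈ F then 0 else isgn j F • z (insert j F)
  map_add' z w := by
    funext F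
    by_cases h : j ∈ F <;> simp [h]
  map_smul' c z := by
    funext F
    by_cases h : j ∈ F
    · simp [h]
    · simp only [h, if_false, Pi.smul_apply, RingHom.id_apply]
      rw [smul_comm]

lemma koszulContract_apply (j : Fin n) (z : Finset (Fin n) → N) (F : Finset (Fin n)) :
    koszulContract R N j z F = if j ∈ F then 0 else isgn j F • z (insert j F) := rfl

/-- The Koszul differential is exterior multiplication by `∑ x_l e_l`, and contraction along `e_j`
is an antiderivation, so their anticommutator is the scalar `x_j`. -/
lemma koszulD_contract (j : Fin n) (z : Finset (Fin n) → N) :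
    koszulD x N (koszulContract R N j z) + koszulContract R N j (koszulD x N z) = x j • z := by
  funext F
  simp only [Pi.add_apply, Pi.smul_apply, koszulD_apply, koszulContract_apply]
  by_cases hj : j ∈ F
  · rw [if_pos hj, add_zero, Finset.sum_eq_single_of_mem j hj]
    · rw [if_neg (Finset.notMem_erase j F), Finset.insert_erase hj, isgn_erase_self,
        smul_comm (x j), smul_smul, isgn_mul_self, one_smul]
    · intro l hl hlj
      rw [if_pos (Finset.mem_erase.2 ⟨Ne.symm hlj, hj⟩), smul_zero, smul_zero]
  · rw [if_neg hj, Finset.sum_insert hj, smul_add, isgn_insert_self, smul_smul, isgn_mul_self,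
      one_smul, Finset.erase_insert hj, Finset.smul_sum, add_comm, add_assoc,
      ← Finset.sum_add_distrib, Finset.sum_eq_zero, add_zero]
    intro l hl
    have hjl : j ≠ l := fun h => hj (h ▸ hl)
    rw [if_neg (fun h => hj (Finset.mem_of_mem_erase h)), Finset.erase_insert_of_ne hjl,
      smul_comm (x l), smul_smul, smul_smul, ← add_smul]
    rw [isgn_insert_mul_add hj hl, zero_smul]

variable (N) in
/-- Exactness of the Koszul cochain complex of `x` with coefficients in `N` at position `i`. -/
def KoszulExact (i : ℕ) : Prop :=
  ∀ z : Finset (Fin n) → N, (∀ F, F.card ≠ i → z F = 0) → koszulD x N z = 0 →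
    ∃ w : Finset (Fin n) → N, (∀ F, F.card + 1 ≠ i → w F = 0) ∧ koszulD x N w = z

variable {x}

lemma koszulD_support {z : Finset (Fin n) → N} {i : ℕ} (hz : ∀ F, F.card + 1 ≠ i → z F = 0)
    (F : Finset (Fin n)) (hF : F.card ≠ i) : koszulD x N z F = 0 := by
  rw [koszulD_apply]
  refine Finset.sum_eq_zero fun l hl => ?_
  rw [hz, smul_zero, smul_zero]
  rwa [Finset.card_erase_add_one hl]

/-- Elements of the ideal generated by `x` act null-homotopically on the Koszul complex. -/
lemma exists_koszul_homotopy {y : R} (hy : y ∈ Ideal.span (Set.range x)) :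
    ∃ h : (Finset (Fin n) → N) →ₗ[R] (Finset (Fin n) → N),
      (∀ z, koszulD x N (h z) + h (koszulD x N z) = y • z) ∧
      ∀ (z : Finset (Fin n) → N) (i : ℕ), (∀ F, F.card ≠ i → z F = 0) →
        ∀ F, F.card + 1 ≠ i → h z F = 0 := by
  obtain ⟨c, rfl⟩ := (Ideal.mem_span_range_iff_exists_fun).1 hy
  refine ⟨∑ j, c j • koszulContract R N j, fun z => ?_, fun z i hz F hF => ?_⟩
  · simp only [LinearMap.sum_apply, LinearMap.smul_apply, map_sum, map_smul]
    rw [← Finset.sum_add_distrib, Finset.sum_smul]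
    refine Finset.sum_congr rfl fun j _ => ?_
    rw [← smul_add, koszulD_contract, smul_smul]
  · simp only [LinearMap.sum_apply, LinearMap.smul_apply, Finset.sum_apply, Pi.smul_apply]
    refine Finset.sum_eq_zero fun j _ => ?_
    rw [koszulContract_apply]
    split_ifs with hj
    · rw [smul_zero]
    · rw [hz _ (by rwa [Finset.card_insert_of_notMem hj]), smul_zero, smul_zero]

open RingTheory.Sequence
open scoped Pointwise

lemma mkQ_eq_zero_iff {y : R} (t : N) :
    (Submodule.mkQ (y • ⊤ : Submodule R N) t : QuotSMulTop y N) = 0 ↔ ∃ s, t = y • s := by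
  rw [Submodule.mkQ_apply, Submodule.Quotient.mk_eq_zero, Submodule.mem_smul_pointwise_iff_exists]
  exact ⟨fun ⟨s, _, h⟩ => ⟨s, h.symm⟩, fun ⟨s, h⟩ => ⟨s, trivial, h.symm⟩⟩

lemma koszulD_mkQ {y : R} (z : Finset (Fin n) → N) (F : Finset (Fin n)) :
    koszulD x (QuotSMulTop y N) (fun F => Submodule.mkQ (y • ⊤ : Submodule R N) (z F)) F =
      Submodule.mkQ (y • ⊤ : Submodule R N) (koszulD x N z F) := by
  simp only [koszulD_apply, map_sum, map_zsmul, map_smul]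

/-- A family which vanishes modulo `y` is divisible by `y`, with the same support. -/
lemma exists_eq_smul_of_mkQ {y : R} (z : Finset (Fin n) → N) (p : Finset (Fin n) → Prop)
    (hp : ∀ F, ¬ p F → z F = 0)
    (hz : ∀ F, Submodule.mkQ (y • ⊤ : Submodule R N) (z F) = 0) :
    ∃ t : Finset (Fin n) → N, (∀ F, ¬ p F → t F = 0) ∧ z = y • t := by
  classical
  choose t ht using fun F => (mkQ_eq_zero_iff (z F)).1 (hz F)
  refine ⟨fun F => if p F then t F else 0, fun F hF => if_neg hF, ?_⟩
  funext F
  by_cases hF : p F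
  · simp [hF, ht F]
  · simp [hF, hp F hF]

lemma exists_lift_mkQ {y : R} (z : Finset (Fin n) → QuotSMulTop y N) (p : Finset (Fin n) → Prop)
    (hp : ∀ F, ¬ p F → z F = 0) :
    ∃ t : Finset (Fin n) → N, (∀ F, ¬ p F → t F = 0) ∧
      z = fun F => Submodule.mkQ (y • ⊤ : Submodule R N) (t F) := by
  classical
  choose t ht using fun F => Submodule.mkQ_surjective (y • ⊤ : Submodule R N) (z F)
  refine ⟨fun F => if p F then t F else 0, fun F hF => if_neg hF, ?_⟩
  funext F
  by_cases hF : p F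
  · simp only [hF, if_true, ht]
  · simp only [hF, if_false, map_zero, hp F hF]

/-- Long exact sequence of `0 → N → N → N/yN → 0`: the group `H^i(N/yN)` lies between `H^i(N)` and
`H^{i+1}(N)`. -/
lemma koszulExact_quotSMulTop {y : R} (hy : IsSMulRegular N y) {i : ℕ} (h0 : KoszulExact x N i)
    (h1 : KoszulExact x N (i + 1)) : KoszulExact x (QuotSMulTop y N) i := by
  intro z hz hdz
  obtain ⟨t, ht, rfl⟩ := exists_lift_mkQ z (fun F => F.card = i) hz
  have hdt : ∀ F, Submodule.mkQ (y • ⊤ : Submodule R N) (koszulD x N t F) = 0 := fun F => by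
    rw [← koszulD_mkQ, hdz]; rfl
  obtain ⟨s, hs, hts⟩ := exists_eq_smul_of_mkQ (koszulD x N t) (fun F => F.card = i + 1)
    (fun F hF => koszulD_support (fun F hF => ht F fun h => hF (by rw [h])) F hF) hdt
  have hds : koszulD x N s = 0 := by
    have h := koszulD_comp x t
    rw [hts, map_smul] at h
    funext F
    exact hy (by simpa using congrFun h F)
  obtain ⟨w, hw, rfl⟩ := h1 s hs hds
  obtain ⟨v, hv, hvt⟩ := h0 (t - y • w)
    (fun F hF => by simp [ht F hF, hw F (fun h => hF (Nat.succ_injective h))])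
    (by rw [map_sub, hts, map_smul, sub_self])
  refine ⟨fun F => Submodule.mkQ (y • ⊤ : Submodule R N) (v F), fun F hF => by
    simp only [hv F hF, map_zero], ?_⟩
  funext F
  rw [koszulD_mkQ, hvt, Pi.sub_apply, map_sub, sub_eq_self, mkQ_eq_zero_iff]
  exact ⟨w F, rfl⟩

/-- Vanishing of `H^{i-1}(N/yN)` makes `y` injective on `H^i(N)`, while `y`, lying in the ideal of
`x`, acts on it as zero. Hence `H^i(N) = 0`. -/
lemma koszulExact_of_quotSMulTop {y : R} (hy : IsSMulRegular N y)
    (hyx : y ∈ Ideal.span (Set.range x)) {i : ℕ}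
    (h : ∀ j, j + 1 = i → KoszulExact x (QuotSMulTop y N) j) : KoszulExact x N i := by
  intro z hz hdz
  obtain ⟨η, hη, hηs⟩ := exists_koszul_homotopy (N := N) hyx
  have h1 : koszulD x N (η z) = y • z := by rw [← hη z, hdz, map_zero, add_zero]
  -- Since `d(η z) = y z`, the family `η z` is a cocycle modulo `y`, hence a coboundary modulo `y`.
  -- Then `y z = y d w`, and `y` cancels. For `i = 0` there is nothing in position `-1`, so `η z =
  -- 0`.
  have key : ∃ v w : Finset (Fin n) → N, (∀ F, F.card + 1 ≠ i → w F = 0) ∧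
      η z = koszulD x N v + y • w := by
    rcases i with _ | j
    · exact ⟨0, 0, fun _ _ => rfl, by
        rw [map_zero, smul_zero, add_zero]; funext F; exact hηs z 0 hz F (by lia)⟩
    · obtain ⟨v', hv', hvz⟩ := h j rfl
        (fun F => Submodule.mkQ (y • ⊤ : Submodule R N) (η z F))
        (fun F hF => by simp only [hηs z _ hz F (fun e => hF (Nat.succ_injective e)), map_zero])
        (by
          funext F
          rw [koszulD_mkQ, h1, Pi.zero_apply, mkQ_eq_zero_iff]
          exact ⟨z F, rfl⟩)
      obtain ⟨v, hv, rfl⟩ := exists_lift_mkQ v' (fun F => F.card + 1 = j) hv'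
      obtain ⟨w, hw, hzw⟩ := exists_eq_smul_of_mkQ (η z - koszulD x N v) (fun F => F.card = j)
        (fun F hF => by
          rw [Pi.sub_apply, koszulD_support hv F hF, sub_zero]
          exact hηs z _ hz F (fun e => hF (Nat.succ_injective e)))
        (fun F => by
          rw [Pi.sub_apply, map_sub, ← koszulD_mkQ, hvz, sub_self])
      exact ⟨v, w, fun F hF => hw F (fun e => hF (by rw [e])), by rw [← hzw]; abel⟩
  obtain ⟨v, w, hw, he⟩ := key
  refine ⟨w, hw, ?_⟩
  rw [he, map_add, koszulD_comp, zero_add, map_smul] at h1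
  funext F
  exact hy (by simpa using congrFun h1 F)

lemma koszulExact_of_isWeaklyRegular {rs : List R} {N : Type*} [AddCommGroup N] [Module R N]
    (hrs : IsWeaklyRegular N rs)
    (hx : ∀ r ∈ rs, r ∈ Ideal.span (Set.range x)) {i : ℕ} (hi : i < rs.length) :
    KoszulExact x N i := by
  induction rs generalizing N i with
  | nil => simp at hi
  | cons r rs ih =>
    rw [isWeaklyRegular_cons_iff] at hrs
    refine koszulExact_of_quotSMulTop hrs.1 (hx r (by simp)) fun j hj => ?_
    exact ih hrs.2 (fun s hs => hx s (by simp [hs])) (by simp at hi; lia)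

lemma exists_isSMulRegular_of_koszulExact_zero [IsNoetherianRing R] [Module.Finite R N]
    (h : KoszulExact x N 0) : ∃ y ∈ Ideal.span (Set.range x), IsSMulRegular N y := by
  -- `H^0` of the Koszul complex consists of the elements killed by all `x_j`, that is, of
  -- `Hom(R/(x), N)`.
  have hs : Subsingleton ((R ⧸ Ideal.span (Set.range x)) →ₗ[R] N) := by
    refine subsingleton_of_forall_eq 0 fun f => ?_
    have hf : ∀ j, x j • f 1 = 0 := fun j => by
      rw [← map_smul, ← map_zero f]
      congr 1
      rw [Algebra.smul_def, mul_one]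
      exact Ideal.Quotient.eq_zero_iff_mem.2 (Ideal.subset_span ⟨j, rfl⟩)
    obtain ⟨w, hw, hwz⟩ := h (fun F => if F = ∅ then f 1 else 0)
      (fun F hF => if_neg fun e => hF (by simp [e]))
      (by
        funext F
        rw [koszulD_apply]
        refine Finset.sum_eq_zero fun l _ => ?_
        split_ifs
        · rw [hf, smul_zero]
        · rw [smul_zero, smul_zero])
    have hw0 : w = 0 := funext fun F => hw F (by lia)
    have hf1 : f 1 = 0 := by
      have := congrFun hwz ∅
      simpa [hw0] using this.symm
    ext
    simpa using hf1
  -- Prime avoidance over the Noetherian ring `R`: if `Hom(R/(x), N) = 0`, the annihilator of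
  -- `R/(x)` contains an `N`-regular element.
  obtain ⟨y, hy, hyN⟩ := IsSMulRegular.subsingleton_linearMap_iff.1 hs
  exact ⟨y, by rwa [Ideal.annihilator_quotient] at hy, hyN⟩

/-- Vanishing of Koszul cohomology below `r` produces a regular sequence of length `r`. -/
lemma exists_isWeaklyRegular_of_koszulExact [IsNoetherianRing R] (r : ℕ) {N : Type*}
    [AddCommGroup N] [Module R N] [Module.Finite R N] (h : ∀ i < r, KoszulExact x N i) :
    ∃ rs : List R, rs.length = r ∧ (∀ s ∈ rs, s ∈ Ideal.span (Set.range x)) ∧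
      IsWeaklyRegular N rs := by
  induction r generalizing N with
  | zero => exact ⟨[], rfl, by simp, IsWeaklyRegular.nil R N⟩
  | succ r ih =>
    obtain ⟨y, hy, hyN⟩ := exists_isSMulRegular_of_koszulExact_zero (h 0 (by lia))
    obtain ⟨rs, hl, hrs, hw⟩ := ih (N := QuotSMulTop y N) fun i hi =>
      koszulExact_quotSMulTop hyN (h i (by lia)) (h (i + 1) (by lia))
    refine ⟨y :: rs, by simp [hl], ?_, hw.cons hyN⟩
    intro s hs
    rcases List.mem_cons.1 hs with rfl | hs
    · exact hy
    · exact hrs s hs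

end Koszul

end SquarefreeMod

namespace SquarefreeMod

variable {k : Type u} [Field k] {n : ℕ}

/-! ### Multiplication maps -/

/-- The multiplication `x^{b - a} : M_a → M_b` for `a ≤ b`. -/
def mulLE (M : GrMod k n) {a b : Deg n} (h : a ≤ b) : M.obj a →ₗ[k] M.obj b :=
  (M.map (homOfLE h)).hom

lemma mulLE_mulLE (M : GrMod k n) {a b c : Deg n} (h : a ≤ b) (h' : b ≤ c) (y : M.obj a) :
    mulLE M h' (mulLE M h y) = mulLE M (h.trans h') y := by
  change (M.map (homOfLE h') : _ → _) (M.map (homOfLE h) y) = _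
  rw [← ModuleCat.comp_apply, ← Functor.map_comp]
  rfl

@[simp]
lemma mulLE_refl (M : GrMod k n) {a : Deg n} (h : a ≤ a) (y : M.obj a) : mulLE M h y = y := by
  have : M.map (homOfLE h) = 𝟙 _ := M.map_id a
  change (M.map (homOfLE h) : _ → _) y = y
  rw [this]
  rfl

lemma mulLE_naturality {M N : GrMod k n} (f : M ⟶ N) {a b : Deg n} (h : a ≤ b) (y : M.obj a) :
    (f.app b).hom (mulLE M h y) = mulLE N h ((f.app a).hom y) :=
  NatTrans.naturality_apply f (homOfLE h) y

/-- Evaluating a family of homogeneous elements at equal indices. -/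
lemma mulLE_congr (M : GrMod k n) {ι : Type*} {f : ι → Deg n} (z : ∀ i, M.obj (f i)) {i j : ι}
    (e : i = j) {b : Deg n} (h : f i ≤ b) (h' : f j ≤ b) :
    mulLE M h (z i) = mulLE M h' (z j) := by
  subst e
  rfl

lemma Deg.ext {a b : Deg n} (h : ∀ i, a.coord i = b.coord i) : a = b := funext h

lemma Deg.le_def {a b : Deg n} : a ≤ b ↔ ∀ i, a.coord i ≤ b.coord i := Iff.rfl

@[simp] lemma Deg.coord_add (a b : Deg n) (i : Fin n) :
    (a + b).coord i = a.coord i + b.coord i := rfl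

@[simp] lemma Deg.coord_sub (a b : Deg n) (i : Fin n) :
    (a - b).coord i = a.coord i - b.coord i := rfl

@[simp] lemma Deg.coord_neg (a : Deg n) (i : Fin n) : (-a).coord i = - a.coord i := rfl

@[simp] lemma Deg.coord_zero (i : Fin n) : (0 : Deg n).coord i = 0 := rfl

@[simp] lemma coord_sqfreeDeg (F : Finset (Fin n)) (i : Fin n) :
    (sqfreeDeg F).coord i = if i ∈ F then 1 else 0 := rfl

lemma mem_posSupp {a : Deg n} {i : Fin n} : i ∈ posSupp a ↔ 0 < a.coord i := by
  simp [posSupp]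

lemma sqfreeDeg_nonneg (F : Finset (Fin n)) : 0 ≤ sqfreeDeg F :=
  Deg.le_def.2 fun i => by simp only [coord_sqfreeDeg, Deg.coord_zero]; split_ifs <;> simp

@[simp]
lemma posSupp_sqfreeDeg (F : Finset (Fin n)) : posSupp (sqfreeDeg F) = F := by
  ext i
  rw [mem_posSupp, coord_sqfreeDeg]
  split_ifs with h <;> simp [h]

lemma IsSquarefree.eq_zero {M : GrMod k n} (hM : IsSquarefree M) {a : Deg n} {i : Fin n}
    (h : a.coord i < 0) (y : M.obj a) : y = 0 :=
  have := hM.subsingleton a fun h' => absurd (Deg.le_def.1 h' i) (by simpa using h)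
  Subsingleton.elim _ _

/-! ### The graded strands of the Koszul complex -/

lemma add_sqfreeDeg_le (a : Deg n) {F G : Finset (Fin n)} (h : F ⊆ G) :
    a + sqfreeDeg F ≤ a + sqfreeDeg G :=
  Deg.le_def.2 fun i => by
    have := Deg.le_def.1 (sqfreeDeg_mono h) i
    simpa using this

/-- The differential of the degree `a` strand of the Koszul complex of `M`, on families of
elements of `M_{a + F}`. -/
def strandD (M : GrMod k n) (a : Deg n) (z : ∀ F, M.obj (a + sqfreeDeg F)) :
    ∀ F, M.obj (a + sqfreeDeg F) :=
  fun F => ∑ l ∈ F, isgn l F • mulLE M (add_sqfreeDeg_le a (F.erase_subset l)) (z (F.erase l))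

lemma strandD_add (M : GrMod k n) (a : Deg n) (z w : ∀ F, M.obj (a + sqfreeDeg F)) :
    strandD M a (z + w) = strandD M a z + strandD M a w := by
  funext F
  simp [strandD, smul_add, Finset.sum_add_distrib]

lemma strandD_neg (M : GrMod k n) (a : Deg n) (z : ∀ F, M.obj (a + sqfreeDeg F)) :
    strandD M a (-z) = - strandD M a z := by
  funext F
  simp [strandD]

lemma strandD_sub (M : GrMod k n) (a : Deg n) (z w : ∀ F, M.obj (a + sqfreeDeg F)) :
    strandD M a (z - w) = strandD M a z - strandD M a w := by
  rw [sub_eq_add_neg, strandD_add, strandD_neg, sub_eq_add_neg]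

/-- Exactness at position `i` of the part of the degree `a` strand of the Koszul complex of `M`
supported on the sets containing `A`. -/
def StrandExact (M : GrMod k n) (a : Deg n) (A : Finset (Fin n)) (i : ℕ) : Prop :=
  ∀ z : (∀ F, M.obj (a + sqfreeDeg F)), (∀ F, ¬ (A ⊆ F ∧ F.card = i) → z F = 0) →
    strandD M a z = 0 → ∃ w : (∀ F, M.obj (a + sqfreeDeg F)),
      (∀ F, ¬ (A ⊆ F ∧ F.card + 1 = i) → w F = 0) ∧ strandD M a w = z

/-! ### Comparison of the strands in degrees `a` and `b = a - e_j` -/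

section Shift

variable {M : GrMod k n} {a b : Deg n} {j : Fin n}
  (hb : ∀ i, b.coord i = a.coord i - if i = j then 1 else 0)

include hb

lemma add_sqfreeDeg_le_of_pred (F : Finset (Fin n)) : b + sqfreeDeg F ≤ a + sqfreeDeg F :=
  Deg.le_def.2 fun i => by
    simp only [Deg.coord_add, hb]
    split_ifs <;> lia

lemma pred_add_insert {F : Finset (Fin n)} (h : j ∉ F) :
    b + sqfreeDeg (insert j F) = a + sqfreeDeg F :=
  Deg.ext fun i => by
    simp only [Deg.coord_add, hb, coord_sqfreeDeg, Finset.mem_insert]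
    by_cases hi : i = j
    · subst hi; simp [h]
    · simp [hi]

lemma add_erase_eq_pred {F : Finset (Fin n)} (h : j ∈ F) :
    a + sqfreeDeg (F.erase j) = b + sqfreeDeg F := by
  rw [← pred_add_insert hb (Finset.notMem_erase j F), Finset.insert_erase h]

/-- The multiplication by `x_j` on strands. -/
def strandUp (z : ∀ F, M.obj (b + sqfreeDeg F)) : ∀ F, M.obj (a + sqfreeDeg F) :=
  fun F => mulLE M (add_sqfreeDeg_le_of_pred hb F) (z F)

/-- Removing `j` from the index sets. -/
def strandStrip (z : ∀ F, M.obj (b + sqfreeDeg F)) : ∀ F, M.obj (a + sqfreeDeg F) :=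
  fun F => if h : j ∈ F then 0 else
    isgn j F • mulLE M (pred_add_insert hb h).le (z (insert j F))

/-- Adding `j` to the index sets. -/
def strandAttach (v : ∀ F, M.obj (a + sqfreeDeg F)) : ∀ F, M.obj (b + sqfreeDeg F) :=
  fun F => if h : j ∈ F then isgn j F • mulLE M (add_erase_eq_pred hb h).le (v (F.erase j)) else 0

omit hb in
variable (j) in
/-- The restriction of a family to the index sets not containing `j`. -/
def strandRes (v : ∀ F, M.obj (a + sqfreeDeg F)) : ∀ F, M.obj (a + sqfreeDeg F) :=
  fun F => if j ∈ F then 0 else v F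

lemma strandD_up (z : ∀ F, M.obj (b + sqfreeDeg F)) :
    strandD M a (strandUp hb z) = strandUp hb (strandD M b z) := by
  funext F
  simp only [strandD, strandUp, map_sum, map_zsmul, mulLE_mulLE]

lemma strandStrip_attach (v : ∀ F, M.obj (a + sqfreeDeg F)) :
    strandStrip hb (strandAttach hb v) = strandRes j v := by
  funext F
  by_cases h : j ∈ F
  · simp [strandStrip, strandRes, h]
  · simp only [strandStrip, strandRes, h, dif_neg, not_false_eq_true, strandAttach,
      Finset.mem_insert_self, dif_pos, map_zsmul, smul_smul, isgn_insert_self, isgn_mul_self,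
      one_smul, mulLE_mulLE, if_false]
    rw [mulLE_congr M v (Finset.erase_insert h) _ le_rfl, mulLE_refl]

lemma strandAttach_strip (hM : IsSquarefree M) (hj : a.coord j = 0)
    (z : ∀ F, M.obj (b + sqfreeDeg F)) : strandAttach hb (strandStrip hb z) = z := by
  funext F
  by_cases h : j ∈ F
  · have h' : j ∉ F.erase j := Finset.notMem_erase j F
    simp only [strandAttach, h, dif_pos, strandStrip, h', dif_neg, not_false_eq_true, map_zsmul,
      smul_smul, isgn_erase_self, isgn_mul_self, one_smul, mulLE_mulLE]
    rw [mulLE_congr M z (Finset.insert_erase h) _ le_rfl, mulLE_refl]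
  · rw [hM.eq_zero (i := j) (by simp [hb, h, hj]) (z F),
      hM.eq_zero (i := j) (by simp [hb, h, hj]) (strandAttach hb _ F)]

lemma strandAttach_res (v : ∀ F, M.obj (a + sqfreeDeg F)) :
    strandAttach hb (strandRes j v) = strandAttach hb v := by
  funext F
  by_cases h : j ∈ F
  · simp [strandAttach, h, strandRes]
  · simp [strandAttach, h]

/-- For `a_j = 0` the strand in degree `b` lives on the sets containing `j`, because otherwise the
`j`-th coordinate is `-1`. `strandAttach` identifies it with the families over `a` on sets avoiding
`j`, moved by one position; hence the sign. -/
lemma strandD_attach (hM : IsSquarefree M) (hj : a.coord j = 0)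
    (v : ∀ F, M.obj (a + sqfreeDeg F)) :
    strandD M b (strandAttach hb v) = - strandAttach hb (strandD M a v) := by
  funext F
  by_cases h : j ∈ F
  · rw [strandD, ← Finset.add_sum_erase _ _ h]
    simp only [Pi.neg_apply, strandAttach, h, dif_pos, strandD, Finset.notMem_erase, dif_neg,
      not_false_eq_true, map_zero, smul_zero, zero_add, map_sum, map_zsmul, Finset.smul_sum,
      ← Finset.sum_neg_distrib]
    refine Finset.sum_congr rfl fun l hl => ?_
    have hl' := Finset.mem_erase.1 hl
    have hjl : j ∈ F.erase l := Finset.mem_erase.2 ⟨Ne.symm hl'.1, h⟩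
    rw [dif_pos hjl, map_zsmul, smul_smul, smul_smul, mulLE_mulLE, mulLE_mulLE,
      isgn_erase_mul hl'.1 hl'.2 h, neg_smul]
    congr 2
    exact mulLE_congr M v Finset.erase_right_comm _ _
  · rw [hM.eq_zero (i := j) (by simp [hb, h, hj]) (strandD M b _ F),
      hM.eq_zero (i := j) (by simp [hb, h, hj]) ((-strandAttach hb _) F)]

/-- Families on sets avoiding `j` form a quotient complex, not a subcomplex. The correction term,
multiplication by `x_j` after `strandAttach`, is the connecting map. -/
lemma strandD_res (v : ∀ F, M.obj (a + sqfreeDeg F)) :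
    strandD M a (strandRes j v) =
      strandRes j (strandD M a v) + strandUp hb (strandAttach hb v) := by
  funext F
  by_cases h : j ∈ F
  · rw [strandD, Finset.sum_eq_single_of_mem j h]
    · simp only [Pi.add_apply, strandRes, h, if_true, zero_add, strandUp, strandAttach, dif_pos,
        map_zsmul, mulLE_mulLE, Finset.notMem_erase, if_false]
    · intro l _ hlj
      simp [strandRes, h, Ne.symm hlj]
  · simp only [Pi.add_apply, strandRes, h, if_false, strandUp, strandAttach, dif_neg,
      not_false_eq_true, map_zero, add_zero, strandD, Finset.mem_erase, and_false]

/-- In degree `a`, the sets containing `A ∪ {j}` give a subcomplex of the strand over `A`, and the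
quotient is the strand of `b` over `A` moved by one position. This is the part `H^{i-1}(a, A) →
H^i(b, A) → H^i(a, A ∪ {j})` of the long exact sequence. -/
lemma strandExact_pred (hM : IsSquarefree M) (hj : a.coord j = 0) {A : Finset (Fin n)}
    (hA : j ∉ A) {i : ℕ} (h1 : StrandExact M a (insert j A) i)
    (h2 : ∀ i', i' + 1 = i → StrandExact M a A i') : StrandExact M b A i := by
  intro z hz hdz
  have hzj : ∀ F, j ∉ F → z F = 0 := fun F h => hM.eq_zero (i := j) (by simp [hb, h, hj]) _
  -- In position `0` only `F = ∅` occurs, and there the `j`-th coordinate of `b` is `-1`, so the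
  -- component of `M` vanishes.
  rcases i with _ | i
  · refine ⟨0, fun _ _ => rfl, ?_⟩
    have hz0 : z = 0 := funext fun F => by
      by_cases hF : j ∈ F
      · exact hz F fun h => by simp [Finset.card_eq_zero.1 h.2] at hF
      · exact hzj F hF
    rw [hz0]
    funext F
    simp [strandD]
  obtain ⟨w, hw, hwz⟩ := h1 (strandUp hb z) (fun F hF => by
    by_cases hjF : j ∈ F
    · rw [strandUp, hz F fun h => hF ⟨Finset.insert_subset hjF h.1, h.2⟩, map_zero]
    · rw [strandUp, hzj F hjF, map_zero]) (by
    rw [strandD_up, hdz]; funext F; exact map_zero _)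
  -- Let `y` be `z` read as a family over `a` on sets avoiding `j`. Its differential is `x_j z`,
  -- which is also `d w`, so `y - w` is a cocycle of the strand over `A` and the second hypothesis
  -- applies to it.
  set y := strandStrip hb z
  have hty : strandAttach hb y = z := strandAttach_strip hb hM hj z
  have hry : strandRes j y = y := by rw [← strandStrip_attach hb y, hty]
  have hdy : strandD M a y = strandD M a w := by
    have h3 := strandD_res hb y
    have h4 := strandD_attach hb hM hj y
    rw [hty, hdz, zero_eq_neg] at h4
    rw [hry, hty, ← strandStrip_attach hb, h4] at h3
    rw [h3, hwz, add_eq_right]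
    funext F
    simp [strandStrip]
  obtain ⟨v, hv, hvy⟩ := h2 i rfl (y - w) (fun F hF => by
    rw [Pi.sub_apply, hw F fun h => hF ⟨(Finset.subset_insert _ _).trans h.1,
      Nat.succ_injective h.2⟩, sub_zero]
    by_cases hjF : j ∈ F
    · simp [y, strandStrip, hjF]
    · simp only [y, strandStrip, hjF, dif_neg, not_false_eq_true]
      rw [hz, map_zero, smul_zero]
      rintro ⟨h3, h4⟩
      rw [Finset.card_insert_of_notMem hjF] at h4
      exact hF ⟨(Finset.subset_insert_iff_of_notMem hA).1 h3, Nat.succ_injective h4⟩)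
    (by rw [strandD_sub, hdy, sub_self])
  refine ⟨- strandAttach hb v, fun F hF => ?_, ?_⟩
  · by_cases hjF : j ∈ F
    · simp only [Pi.neg_apply, strandAttach, hjF, dif_pos]
      rw [hv, map_zero, smul_zero, neg_zero]
      rintro ⟨h3, h4⟩
      rw [Finset.card_erase_add_one hjF] at h4
      exact hF ⟨h3.trans (Finset.erase_subset _ _), by rw [h4]⟩
    · simp [strandAttach, hjF]
  · rw [strandD_neg, strandD_attach hb hM hj, neg_neg, hvy]
    have hw0 : strandRes j w = 0 := funext fun F => by
      by_cases hjF : j ∈ F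
      · simp [strandRes, hjF]
      · simp only [strandRes, hjF, if_false]
        exact hw F fun h => hjF (h.1 (Finset.mem_insert_self _ _))
    rw [← strandAttach_res, ← hty, ← strandAttach_res hb y]
    congr 1
    have : strandRes j (y - w) = strandRes j y - strandRes j w := funext fun F => by
      by_cases hjF : j ∈ F <;> simp [strandRes, hjF]
    rw [this, hw0, sub_zero]

/-- The part `H^i(b, A) → H^i(a, A ∪ {j}) → H^i(a, A)` of the same long exact sequence. -/
lemma strandExact_insert (hM : IsSquarefree M) (hj : a.coord j = 0) {A : Finset (Fin n)}
    {i : ℕ} (h1 : StrandExact M a A i) (h2 : StrandExact M b A i) :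
    StrandExact M a (insert j A) i := by
  intro z hz hdz
  obtain ⟨w, hw, rfl⟩ := h1 z (fun F hF => hz F fun h =>
    hF ⟨(Finset.subset_insert _ _).trans h.1, h.2⟩) hdz
  have hr : strandRes j (strandD M a w) = 0 := funext fun F => by
    by_cases hjF : j ∈ F
    · simp [strandRes, hjF]
    · simp only [strandRes, hjF, if_false]
      exact hz F fun h => hjF (h.1 (Finset.mem_insert_self _ _))
  have hat : strandAttach hb (0 : ∀ F, M.obj (a + sqfreeDeg F)) = 0 := funext fun F => by
    simp [strandAttach]
  obtain ⟨v, hv, hvw⟩ := h2 (strandAttach hb w) (fun F hF => by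
      by_cases hjF : j ∈ F
      · simp only [strandAttach, hjF, dif_pos]
        rw [hw, map_zero, smul_zero]
        rintro ⟨h3, h4⟩
        rw [Finset.card_erase_add_one hjF] at h4
        exact hF ⟨h3.trans (Finset.erase_subset _ _), h4⟩
      · simp [strandAttach, hjF])
    (by rw [strandD_attach hb hM hj, ← strandAttach_res, hr, hat, neg_zero])
  -- Discarding the part of `w` on sets avoiding `j` changes `d w` by `x_j` times the attached
  -- family, which is `d v`; adding `x_j v` repairs this and stays on sets containing `j`.
  refine ⟨w - strandRes j w + strandUp hb v, fun F hF => ?_, ?_⟩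
  · by_cases hjF : j ∈ F
    · have : ¬ (A ⊆ F ∧ F.card + 1 = i) := fun h => hF ⟨Finset.insert_subset hjF h.1, h.2⟩
      simp [strandRes, hjF, strandUp, hw F this, hv F this]
    · have : v F = 0 := hM.eq_zero (i := j) (by simp [hb, hjF, hj]) _
      simp [strandRes, hjF, strandUp, this]
  · rw [strandD_add, strandD_sub, strandD_up, hvw, strandD_res hb, hr, zero_add, sub_add_cancel]

end Shift

end SquarefreeMod

namespace SquarefreeMod

variable {k : Type u} [Field k] {n : ℕ}

/-! ### Reduction of all Koszul strands to the strands in degree zero -/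

section Reduction

variable {M : GrMod k n} (hM : IsSquarefree M)

include hM

/-- The squarefree condition without the assumption `a ≥ 0`: only positive coordinates change, so a
negative coordinate of `a` is still negative in `b` and both components vanish. -/
lemma mulLE_bijective {a b : Deg n} (h : a ≤ b)
    (hs : ∀ i, a.coord i ≠ b.coord i → 0 < a.coord i) : Function.Bijective (mulLE M h) := by
  by_cases ha : 0 ≤ a
  · refine hM.bijective a b h ha (Finset.ext fun i => ?_)
    rw [mem_posSupp, mem_posSupp]
    by_cases hi : a.coord i = b.coord i
    · rw [hi]
    · exact ⟨fun _ => hs i hi, fun h' => h'.trans_le (Deg.le_def.1 h i)⟩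
  · obtain ⟨i, hi⟩ : ∃ i, a.coord i < 0 := by
      by_contra! h'
      exact ha (Deg.le_def.2 h')
    have hi' : b.coord i < 0 := by
      by_cases hab : a.coord i = b.coord i
      · rwa [← hab]
      · have := hs i hab; lia
    exact ⟨fun y y' _ => (hM.eq_zero hi y).trans (hM.eq_zero hi y').symm,
      fun y => ⟨0, (hM.eq_zero hi' _).trans (hM.eq_zero hi' y).symm⟩⟩

/-- When `a_j > 0`, multiplication by `x_j` from `M_{a+F}` to `M_{a+F∪{j}}` is bijective, so the
strand is the cone of an isomorphism. A primitive of `z` is obtained by dividing its values on the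
sets containing `j` by `x_j`. Since `j ∉ A`, removing `j` preserves the condition `A ⊆ F`. -/
lemma strandExact_of_pos {a : Deg n} {j : Fin n} (hj : 0 < a.coord j) {A : Finset (Fin n)}
    (hA : j ∉ A) (i : ℕ) : StrandExact M a A i := by
  intro z hz hdz
  have hbij : ∀ F : Finset (Fin n), Function.Bijective
      (mulLE M (add_sqfreeDeg_le a (Finset.subset_insert j F))) := fun F => by
    refine mulLE_bijective hM _ fun i hi => ?_
    have hij : i = j := by
      by_contra hne
      simp [hne] at hi
    subst hij
    simp only [Deg.coord_add, coord_sqfreeDeg]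
    split_ifs <;> lia
  choose v hv using fun F => (hbij F).2 (isgn j F • z (insert j F))
  have hdv : strandD M a (fun F => if j ∈ F then 0 else v F) = z := by
    funext F
    by_cases hF : j ∈ F
    · rw [strandD, Finset.sum_eq_single_of_mem j hF]
      · have h := congrArg (mulLE M (add_sqfreeDeg_le a (Finset.insert_erase hF).subset))
          (hv (F.erase j))
        rw [mulLE_mulLE, map_zsmul, isgn_erase_self, mulLE_congr M z (Finset.insert_erase hF) _
          le_rfl, mulLE_refl] at h
        simp only [Finset.notMem_erase, if_false]
        rw [h, smul_smul, isgn_mul_self, one_smul]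
      · intro l _ hlj
        simp [hF, Ne.symm hlj]
    · apply (hbij F).1
      have hz' := congrFun hdz (insert j F)
      rw [strandD, Finset.sum_insert hF, Pi.zero_apply, mulLE_congr M z (Finset.erase_insert hF)
        _ (add_sqfreeDeg_le a (Finset.subset_insert j F)), isgn_insert_self] at hz'
      have hz'' := congrArg (isgn j F • ·) hz'
      simp only [smul_add, smul_smul, isgn_mul_self, one_smul, smul_zero, Finset.smul_sum] at hz''
      rw [eq_neg_of_add_eq_zero_left hz'', ← Finset.sum_neg_distrib, strandD, map_sum]
      refine Finset.sum_congr rfl fun l hl => ?_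
      have hjl : j ≠ l := fun h => hF (h ▸ hl)
      have hsub : insert j (F.erase l) ⊆ insert j F := Finset.insert_subset_insert _
        (Finset.erase_subset _ _)
      have h := congrArg (mulLE M (add_sqfreeDeg_le a hsub)) (hv (F.erase l))
      rw [mulLE_mulLE, map_zsmul] at h
      rw [if_neg fun h => hF (Finset.mem_of_mem_erase h), map_zsmul, mulLE_mulLE, h, smul_smul,
        mulLE_congr M z (Finset.erase_insert_of_ne hjl) _ (add_sqfreeDeg_le a hsub), ← neg_smul,
        eq_neg_of_add_eq_zero_left (isgn_insert_mul_add hF hl), neg_neg]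
  refine ⟨_, fun F hF => ?_, hdv⟩
  split_ifs with hjF
  · rfl
  · apply (hbij F).1
    rw [hv, map_zero, hz, smul_zero]
    rintro ⟨h', h⟩
    rw [Finset.card_insert_of_notMem hjF] at h
    exact hF ⟨(Finset.subset_insert_iff_of_notMem hA).1 h', h⟩

lemma strandExact_of_neg {a : Deg n} {j : Fin n} (hj : a.coord j < -1) (i : ℕ) :
    StrandExact M a ∅ i := fun z _ _ => ⟨0, fun _ _ => rfl, funext fun F => by
  have h : (a + sqfreeDeg F).coord j < 0 := by
    simp only [Deg.coord_add, coord_sqfreeDeg]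
    split_ifs <;> lia
  rw [hM.eq_zero h (z F), hM.eq_zero h (strandD M a 0 F)]⟩

lemma strandExact_forall_iff_neg (i : ℕ) :
    (∀ a, StrandExact M a ∅ i) ↔ ∀ B : Finset (Fin n), StrandExact M (-sqfreeDeg B) ∅ i := by
  refine ⟨fun h B => h _, fun h a => ?_⟩
  by_cases h1 : ∃ j, 0 < a.coord j
  · exact strandExact_of_pos hM h1.choose_spec (Finset.notMem_empty _) i
  by_cases h2 : ∃ j, a.coord j < -1
  · exact strandExact_of_neg hM h2.choose_spec i
  push Not at h1 h2
  -- All coordinates of `a` are now `0` or `-1`.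
  have : a = -sqfreeDeg (Finset.univ.filter fun i => a.coord i ≠ 0) := Deg.ext fun i => by
    have := h1 i
    have := h2 i
    simp only [Deg.coord_neg, coord_sqfreeDeg, Finset.mem_filter, Finset.mem_univ, true_and]
    split_ifs <;> lia
  rw [this]
  exact h _

/-- Both directions go through the strands in degree `-B` over `A` with `A` and `B` disjoint:
`strandExact_insert` enlarges `A` starting from `A = ∅`, and `strandExact_pred` enlarges `B`
starting from `B = ∅`. The latter also uses position `i - 1`, so the equivalence is stated for a
whole range `i < r`. -/
lemma strandExact_iff_localized (r : ℕ) :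
    (∀ i < r, ∀ a, StrandExact M a ∅ i) ↔ ∀ i < r, ∀ A, StrandExact M 0 A i := by
  have hb : ∀ (j : Fin n) (B : Finset (Fin n)), j ∉ B → ∀ i,
      (-sqfreeDeg (insert j B)).coord i = (-sqfreeDeg B).coord i - if i = j then 1 else 0 := by
    intro j B hj i
    simp only [Deg.coord_neg, coord_sqfreeDeg, Finset.mem_insert]
    by_cases hi : i = j
    · subst hi; simp [hj]
    · simp [hi]
  have h0 : -sqfreeDeg (∅ : Finset (Fin n)) = 0 := Deg.ext fun i => by simp
  have h0' : ∀ (j : Fin n) (B : Finset (Fin n)), j ∉ B → (-sqfreeDeg B).coord j = 0 := by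
    intro j B hj
    simp [hj]
  constructor
  · intro h
    have key : ∀ A B : Finset (Fin n), Disjoint A B → ∀ i < r,
        StrandExact M (-sqfreeDeg B) A i := by
      intro A
      induction A using Finset.induction_on with
      | empty => exact fun B _ i hi => h i hi _
      | insert j A hj ih =>
        intro B hB i hi
        rw [Finset.disjoint_insert_left] at hB
        refine strandExact_insert (hb j B hB.1) hM (h0' j B hB.1) (ih B hB.2 i hi)
          (ih _ ?_ i hi)
        rw [Finset.disjoint_insert_right]
        exact ⟨hj, hB.2⟩
    intro i hi A
    rw [← h0]
    exact key A ∅ (Finset.disjoint_empty_right _) i hi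
  · intro h
    have key : ∀ B A : Finset (Fin n), Disjoint A B → ∀ i < r,
        StrandExact M (-sqfreeDeg B) A i := by
      intro B
      induction B using Finset.induction_on with
      | empty => rw [h0]; exact fun A _ i hi => h i hi A
      | insert j B hj ih =>
        intro A hA i hi
        rw [Finset.disjoint_insert_right] at hA
        refine strandExact_pred (hb j B hj) hM (h0' j B hj) hA.1 (ih _ ?_ i hi)
          fun i' hi' => ih A hA.2 i' (by lia)
        rw [Finset.disjoint_insert_left]
        exact ⟨hj, hA.2⟩
    intro i hi
    rw [strandExact_forall_iff_neg hM]
    exact fun B => key B ∅ (Finset.disjoint_empty_left _) i hi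

end Reduction

/-! ### Strands and the Koszul complex of the underlying module -/

section Total

open MvPolynomial

variable {M : GrMod k n}

/-- The component of degree `a` of an element of `⨁ M_a`. -/
def Total.comp (M : GrMod k n) (a : Deg n) : Total M →ₗ[k] M.obj a :=
  DirectSum.component k (Deg n) (fun a => M.obj a) a

lemma Total.comp_of_self (a : Deg n) (y : M.obj a) : Total.comp M a (Total.of M a y) = y :=
  DirectSum.component.lof_self (R := k) (M := fun a => M.obj a) a y

lemma Total.comp_of_ne {a b : Deg n} (h : a ≠ b) (y : M.obj a) :
    Total.comp M b (Total.of M a y) = 0 := by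
  refine (DirectSum.component.of (R := k) (M := fun a => M.obj a) b a y).trans ?_
  rw [dif_neg h]

lemma Total.ext {t s : Total M} (h : ∀ a, Total.comp M a t = Total.comp M a s) : t = s :=
  DirectSum.ext_component k h

lemma Total.induction {p : Total M → Prop} (t : Total M) (h0 : p 0)
    (hof : ∀ a y, p (Total.of M a y)) (hadd : ∀ s t, p s → p t → p (s + t)) : p t :=
  DirectSum.induction_on (motive := p) t h0 hof hadd

lemma Total.finite_comp (t : Total M) : {a | Total.comp M a t ≠ 0}.Finite := by
  induction t using Total.induction with
  | h0 => simp
  | hof a y =>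
    refine (Set.finite_singleton a).subset fun b hb => ?_
    by_contra hne
    exact hb (Total.comp_of_ne (Ne.symm hne) y)
  | hadd s t hs ht =>
    refine (hs.union ht).subset fun b hb => ?_
    by_contra hne
    simp only [Set.mem_union, Set.mem_ofPred_eq, not_or, not_not] at hne
    exact hb (by rw [map_add, hne.1, hne.2, add_zero])

lemma Total.X_smul_of {a b : Deg n} {j : Fin n} (h : a ≤ b)
    (hb : ∀ i, b.coord i = a.coord i + if i = j then 1 else 0) (y : M.obj a) :
    (X j : MvPolynomial (Fin n) k) • Total.of M a y = Total.of M b (mulLE M h y) := by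
  rw [X, Total.monomial_smul, one_smul]
  refine Total.of_map_congr M (Deg.ext fun i => ?_) _ _ y
  rw [hb, Deg.coord_add]
  congr 1
  change ((Finsupp.single j 1 i : ℕ) : ℤ) = _
  rw [Finsupp.single_apply]
  simp only [eq_comm]
  split_ifs <;> rfl

lemma Total.comp_X_smul {a b : Deg n} {j : Fin n} (h : a ≤ b)
    (hb : ∀ i, b.coord i = a.coord i + if i = j then 1 else 0) (t : Total M) :
    Total.comp M b ((X j : MvPolynomial (Fin n) k) • t) = mulLE M h (Total.comp M a t) := by
  induction t using Total.induction with
  | h0 => simp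
  | hof c y =>
    have hc : ∀ i, (c + sqfreeDeg {j}).coord i = c.coord i + if i = j then 1 else 0 := by simp
    have hle : c ≤ c + sqfreeDeg {j} := Deg.le_def.2 fun i => by
      rw [hc]; split_ifs <;> lia
    rw [Total.X_smul_of hle hc]
    by_cases e : c = a
    · subst e
      have e' : c + sqfreeDeg {j} = b := Deg.ext fun i => by rw [hc, hb]
      subst e'
      rw [Total.comp_of_self, Total.comp_of_self]
    · rw [Total.comp_of_ne e, map_zero, Total.comp_of_ne]
      intro e'
      refine e (Deg.ext fun i => ?_)
      have h1 := hb i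
      rw [← e', hc] at h1
      lia
  | hadd s t hs ht => rw [smul_add, map_add, map_add, hs, ht, map_add]

lemma coord_add_erase (a : Deg n) {l : Fin n} {F : Finset (Fin n)} (hl : l ∈ F) (i : Fin n) :
    (a + sqfreeDeg F).coord i =
      (a + sqfreeDeg (F.erase l)).coord i + if i = l then 1 else 0 := by
  simp only [Deg.coord_add, coord_sqfreeDeg, Finset.mem_erase]
  by_cases h : i = l
  · subst h; simp [hl]
  · simp [h]

lemma comp_koszulD (a : Deg n) (Z : Finset (Fin n) → Total M) (F : Finset (Fin n)) :
    Total.comp M (a + sqfreeDeg F)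
        (koszulD (X : Fin n → MvPolynomial (Fin n) k) (Total M) Z F) =
      strandD M a (fun F => Total.comp M (a + sqfreeDeg F) (Z F)) F := by
  rw [koszulD_apply, map_sum, strandD]
  refine Finset.sum_congr rfl fun l hl => ?_
  rw [map_zsmul, Total.comp_X_smul (add_sqfreeDeg_le a (F.erase_subset l)) (coord_add_erase a hl)]

lemma koszulD_of (a : Deg n) (z : ∀ F, M.obj (a + sqfreeDeg F)) (F : Finset (Fin n)) :
    koszulD (X : Fin n → MvPolynomial (Fin n) k) (Total M)
        (fun F => Total.of M (a + sqfreeDeg F) (z F)) F =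
      Total.of M (a + sqfreeDeg F) (strandD M a z F) := by
  rw [koszulD_apply, strandD, map_sum]
  refine Finset.sum_congr rfl fun l hl => ?_
  rw [map_zsmul, Total.X_smul_of (add_sqfreeDeg_le a (F.erase_subset l)) (coord_add_erase a hl)]

/-- The Koszul complex of `⨁ M_a` is the direct sum of its strands. -/
lemma koszulExact_total_iff (i : ℕ) :
    KoszulExact (X : Fin n → MvPolynomial (Fin n) k) (Total M) i ↔
      ∀ a, StrandExact M a ∅ i := by
  constructor
  · intro h a z hz hdz
    obtain ⟨W, hW, hWz⟩ := h (fun F => Total.of M (a + sqfreeDeg F) (z F))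
      (fun F hF => by rw [hz F fun h => hF h.2, map_zero])
      (by funext F; rw [koszulD_of, hdz]; exact map_zero _)
    refine ⟨fun F => Total.comp M (a + sqfreeDeg F) (W F), fun F hF => ?_, ?_⟩
    · dsimp only
      rw [hW F fun h => hF ⟨Finset.empty_subset _, h⟩, map_zero]
    · funext F
      rw [← comp_koszulD, hWz, Total.comp_of_self]
  · intro h Z hZ hdZ
    let z : ∀ a F, M.obj (a + sqfreeDeg F) := fun a F => Total.comp M (a + sqfreeDeg F) (Z F)
    have hex : ∀ a, ∃ w : (∀ F, M.obj (a + sqfreeDeg F)),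
        (∀ F : Finset (Fin n), F.card + 1 ≠ i → w F = 0) ∧ strandD M a w = z a := fun a => by
      obtain ⟨w, hw, hwz⟩ := h a (z a) (fun F hF => by
          simp only [z]
          rw [hZ F fun h => hF ⟨Finset.empty_subset _, h⟩, map_zero])
        (by funext F; rw [← comp_koszulD, hdZ]; exact map_zero _)
      exact ⟨w, fun F hF => hw F fun h => hF h.2, hwz⟩
    choose w hw hwz using hex
    -- Only finitely many strands see `Z`, so the primitives chosen strand by strand add up to an
    -- element of the direct sum.
    have hfin : {a | ∃ F, z a F ≠ 0}.Finite := by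
      have : {a | ∃ F, z a F ≠ 0} ⊆
          ⋃ F, (fun a => a - sqfreeDeg F) '' {a | Total.comp M a (Z F) ≠ 0} := by
        rintro a ⟨F, hF⟩
        exact Set.mem_iUnion.2 ⟨F, a + sqfreeDeg F, hF, add_sub_cancel_right _ _⟩
      exact (Set.finite_iUnion fun F => (Total.finite_comp (Z F)).image _).subset this
    refine ⟨fun F => ∑ a ∈ hfin.toFinset, Total.of M (a + sqfreeDeg F) (w a F),
      fun F hF => Finset.sum_eq_zero fun a _ => by rw [hw a F hF, map_zero], ?_⟩
    have hsum : (fun F => ∑ a ∈ hfin.toFinset, Total.of M (a + sqfreeDeg F) (w a F)) =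
        ∑ a ∈ hfin.toFinset, fun F => Total.of M (a + sqfreeDeg F) (w a F) := by
      funext F
      rw [Finset.sum_apply]
    rw [hsum, map_sum]
    funext F
    rw [Finset.sum_apply]
    simp only [koszulD_of, hwz]
    refine Total.ext fun b => ?_
    rw [map_sum]
    have hb : b = (b - sqfreeDeg F) + sqfreeDeg F := (sub_add_cancel _ _).symm
    have hne : ∀ a, a ≠ b - sqfreeDeg F → a + sqfreeDeg F ≠ b := fun a ha h =>
      ha (eq_sub_of_add_eq h)
    by_cases hz0 : z (b - sqfreeDeg F) F = 0
    · rw [Finset.sum_eq_zero]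
      · symm
        have := hz0
        simp only [z] at this
        rwa [← hb] at this
      · intro a _
        by_cases ha : a = b - sqfreeDeg F
        · rw [ha, hz0, map_zero, map_zero]
        · rw [Total.comp_of_ne (hne a ha)]
    · rw [Finset.sum_eq_single_of_mem (b - sqfreeDeg F)
        (hfin.mem_toFinset.2 ⟨F, hz0⟩) fun a _ ha => Total.comp_of_ne (hne a ha) _]
      generalize b - sqfreeDeg F = c at hb
      subst hb
      rw [Total.comp_of_self]

end Total

end SquarefreeMod

namespace SquarefreeMod

open MvPolynomial

variable {k : Type u} [Field k] {n : ℕ} {M : GrMod k n}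

/-! ### Generators of the underlying module -/

lemma Total.C_smul (c : k) (t : Total M) : (C c : MvPolynomial (Fin n) k) • t = c • t := by
  change polyAct M (algebraMap k _ c) t = c • t
  rw [AlgHom.commutes]
  rfl

lemma coord_monDeg (m : Fin n →₀ ℕ) (i : Fin n) : (monDeg m).coord i = m i := rfl

lemma monDeg_injective : Function.Injective (monDeg (n := n)) := fun m m' h =>
  Finsupp.ext fun i => by
    have := congrArg (fun a => Deg.coord a i) h
    simpa [coord_monDeg] using this

lemma exists_add_monDeg {a b : Deg n} (h : a ≤ b) : ∃ m, b = a + monDeg m :=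
  ⟨Finsupp.equivFunOnFinite.symm fun i => (b.coord i - a.coord i).toNat, Deg.ext fun i => by
    have := Deg.le_def.1 h i
    simp only [Deg.coord_add, coord_monDeg, Finsupp.equivFunOnFinite_symm_apply_apply]
    lia⟩

lemma Total.comp_smul_of (s : MvPolynomial (Fin n) k) (a : Deg n) (y : M.obj a)
    (m : Fin n →₀ ℕ) :
    Total.comp M (a + monDeg m) (s • Total.of M a y) =
      coeff m s • mulLE M (le_add_monDeg a m) y := by
  induction s using MvPolynomial.induction_on' with
  | monomial u c =>
    rw [Total.monomial_smul, map_smul, coeff_monomial]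
    split_ifs with h
    · subst h
      rw [Total.comp_of_self]
      rfl
    · rw [Total.comp_of_ne, smul_zero, zero_smul]
      exact fun e => h (monDeg_injective (add_left_cancel e))
  | add p q hp hq => rw [add_smul, map_add, hp, hq, coeff_add, add_smul]

lemma posSupp_le {a : Deg n} (ha : 0 ≤ a) : sqfreeDeg (posSupp a) ≤ a :=
  Deg.le_def.2 fun i => by
    have := Deg.le_def.1 ha i
    simp only [coord_sqfreeDeg, mem_posSupp, Deg.coord_zero] at this ⊢
    split_ifs <;> lia

section Squarefree

variable (hM : IsSquarefree M)

include hM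

lemma exists_eq_mulLE_sqfreeDeg {a : Deg n} (ha : 0 ≤ a) (y : M.obj a) :
    ∃ y', mulLE M (posSupp_le ha) y' = y :=
  (hM.bijective _ _ (posSupp_le ha) (sqfreeDeg_nonneg _) (posSupp_sqfreeDeg _).symm).2 y

lemma span_sqfree_eq_top :
    Submodule.span (MvPolynomial (Fin n) k)
      {t : Total M | ∃ F y, t = Total.of M (sqfreeDeg F) y} = ⊤ := by
  refine eq_top_iff.2 fun t _ => ?_
  induction t using Total.induction with
  | h0 => exact zero_mem _
  | hof a y =>
    by_cases ha : 0 ≤ a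
    · obtain ⟨y', rfl⟩ := exists_eq_mulLE_sqfreeDeg hM ha y
      obtain ⟨m, hm⟩ := exists_add_monDeg (posSupp_le ha)
      have : Total.of M a (mulLE M (posSupp_le ha) y') =
          monomial m (1 : k) • Total.of M (sqfreeDeg (posSupp a)) y' := by
        rw [Total.monomial_smul, one_smul]
        exact Total.of_map_congr M hm _ _ y'
      rw [this]
      exact Submodule.smul_mem _ _ (Submodule.subset_span ⟨_, _, rfl⟩)
    · have := hM.subsingleton a ha
      rw [Subsingleton.elim y 0, map_zero]
      exact zero_mem _
  | hadd s t hs ht => exact add_mem (hs trivial) (ht trivial)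

lemma Total.finite : Module.Finite (MvPolynomial (Fin n) k) (Total M) := by
  have h : ∀ F : Finset (Fin n), ∃ s : Finset (M.obj (sqfreeDeg F)),
      Submodule.span k (s : Set (M.obj (sqfreeDeg F))) = ⊤ := fun F =>
    (hM.finite _ (sqfreeDeg_nonneg F)).fg_top
  choose s hs using h
  refine ⟨Submodule.fg_def.2 ⟨⋃ F, Total.of M (sqfreeDeg F) '' (s F),
    Set.finite_iUnion fun F => (s F).finite_toSet.image _, ?_⟩⟩
  rw [eq_top_iff, ← span_sqfree_eq_top hM, Submodule.span_le]
  rintro _ ⟨F, y, rfl⟩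
  have hy : y ∈ Submodule.span k (s F : Set (M.obj (sqfreeDeg F))) := hs F ▸ Submodule.mem_top
  induction hy using Submodule.span_induction with
  | mem y hy => exact Submodule.subset_span (Set.mem_iUnion.2 ⟨F, y, hy, rfl⟩)
  | zero => rw [map_zero]; exact zero_mem _
  | add y y' _ _ h h' => rw [map_add]; exact add_mem h h'
  | smul c y _ h =>
    rw [map_smul, ← Total.C_smul]
    exact Submodule.smul_mem _ _ h

/-- If `M` is nonzero, then it has a nonzero squarefree component. -/
lemma exists_nontrivial_sqfreeDeg {a : Deg n} (ha : Nontrivial (M.obj a)) :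
    ∃ F, Nontrivial (M.obj (sqfreeDeg F)) := by
  by_cases h : 0 ≤ a
  · refine ⟨posSupp a, ?_⟩
    obtain ⟨y, hy⟩ := exists_ne (0 : M.obj a)
    obtain ⟨y', rfl⟩ := exists_eq_mulLE_sqfreeDeg hM h y
    exact ⟨y', 0, fun e => hy (by rw [e, map_zero])⟩
  · have := hM.subsingleton a h
    exact absurd ha (not_nontrivial _)

/-- Nakayama by degrees: for a minimal `G` with `M_G ≠ 0`, every variable maps into `M_G` from a
zero component, so no nonzero element of `M_G` lies in `𝔪M`. This turns weakly regular sequences in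
`𝔪` into regular ones. -/
lemma top_ne_smul_top {F : Finset (Fin n)} (hF : Nontrivial (M.obj (sqfreeDeg F)))
    {I : Ideal (MvPolynomial (Fin n) k)}
    (hI : I ≤ Ideal.span (Set.range (X : Fin n → MvPolynomial (Fin n) k))) :
    (⊤ : Submodule (MvPolynomial (Fin n) k) (Total M)) ≠ I • ⊤ := by
  obtain ⟨G, hG, hmin⟩ := exists_minimal_of_wellFoundedLT
    (fun G : Finset (Fin n) => Nontrivial (M.obj (sqfreeDeg G))) ⟨F, hF⟩
  have hX : ∀ (j : Fin n) (t : Total M),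
      Total.comp M (sqfreeDeg G) ((X j : MvPolynomial (Fin n) k) • t) = 0 := by
    intro j t
    have hle : sqfreeDeg G - sqfreeDeg {j} ≤ sqfreeDeg G := Deg.le_def.2 fun i => by
      simp only [Deg.coord_sub, coord_sqfreeDeg]
      split_ifs <;> lia
    rw [Total.comp_X_smul hle (fun i => by simp)]
    by_cases hj : j ∈ G
    · have : sqfreeDeg G - sqfreeDeg {j} = sqfreeDeg (G.erase j) := Deg.ext fun i => by
        by_cases hi : i = j
        · subst hi; simp [hj]
        · simp [hi]
      have hs : Subsingleton (M.obj (sqfreeDeg G - sqfreeDeg {j})) := by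
        by_contra hne
        rw [not_subsingleton_iff_nontrivial, this] at hne
        exact Finset.notMem_erase j G (hmin hne (Finset.erase_subset j G) hj)
      rw [Subsingleton.elim (Total.comp M (sqfreeDeg G - sqfreeDeg {j}) t) 0, map_zero]
    · rw [hM.eq_zero (i := j) (by simp [hj]) (Total.comp M (sqfreeDeg G - sqfreeDeg {j}) t),
        map_zero]
  have hker : ∀ t ∈ I • (⊤ : Submodule (MvPolynomial (Fin n) k) (Total M)),
      Total.comp M (sqfreeDeg G) t = 0 := by
    intro t ht
    induction ht using Submodule.smul_induction_on' with
    | smul r hr t _ =>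
      obtain ⟨c, rfl⟩ := (Ideal.mem_span_range_iff_exists_fun).1 (hI hr)
      rw [Finset.sum_smul, map_sum]
      refine Finset.sum_eq_zero fun j _ => ?_
      rw [mul_comm, mul_smul, hX]
    | add t _ s _ h h' => rw [map_add, h, h', add_zero]
  intro h
  obtain ⟨y, hy⟩ := exists_ne (0 : M.obj (sqfreeDeg G))
  apply hy
  rw [← Total.comp_of_self (sqfreeDeg G) y]
  exact hker _ (h ▸ Submodule.mem_top)

/-! ### The Krull dimension -/

/-- Monomials in the variables of `F` act injectively on `M_F`, so a nonzero `y ∈ M_F` has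
annihilator inside `P_F`. Hence the support contains `V(P_F)`, of dimension `|F|`. -/
lemma card_le_supportDim {F : Finset (Fin n)} (hF : Nontrivial (M.obj (sqfreeDeg F))) :
    (F.card : WithBot ℕ∞) ≤ Module.supportDim (MvPolynomial (Fin n) k) (Total M) := by
  obtain ⟨y, hy⟩ := exists_ne (0 : M.obj (sqfreeDeg F))
  let π : MvPolynomial (Fin n) k →ₐ[k] MvPolynomial F k :=
    aeval fun i => if h : i ∈ F then X ⟨i, h⟩ else 0
  have hπ : Function.Surjective π := by
    intro p
    refine ⟨rename Subtype.val p, ?_⟩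
    rw [aeval_rename]
    have : ((fun i : Fin n => if h : i ∈ F then (X ⟨i, h⟩ : MvPolynomial F k) else 0) ∘
        Subtype.val) = X := by
      funext i
      simp
    rw [this, aeval_X_left_apply]
  have hann : (Submodule.span (MvPolynomial (Fin n) k)
      {Total.of M (sqfreeDeg F) y}).annihilator ≤ RingHom.ker π := by
    intro s hs
    rw [Submodule.mem_annihilator_span_singleton] at hs
    rw [RingHom.mem_ker]
    change aeval _ s = 0
    rw [aeval_def, eval₂_eq]
    refine Finset.sum_eq_zero fun m hm => ?_
    obtain ⟨i, hi, hiF⟩ : ∃ i ∈ m.support, i ∉ F := by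
      by_contra! h
      have hc := Total.comp_smul_of s (sqfreeDeg F) y m
      rw [hs, map_zero] at hc
      rcases smul_eq_zero.1 hc.symm with hc | hc
      · exact mem_support_iff.1 hm hc
      · apply hy
        refine (mulLE_bijective hM (le_add_monDeg (sqfreeDeg F) m) fun i hi => ?_).1
          (hc.trans (map_zero _).symm)
        have : i ∈ m.support := by
          rw [Finsupp.mem_support_iff]
          intro h0
          apply hi
          simp [coord_monDeg, h0]
        simp [h i this]
    rw [Finset.prod_eq_zero hi, mul_zero]
    rw [dif_neg hiF, zero_pow (Finsupp.mem_support_iff.1 hi)]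
  calc (F.card : WithBot ℕ∞) = ringKrullDim (MvPolynomial F k) := by
        rw [MvPolynomial.ringKrullDim_of_isNoetherianRing, ringKrullDim_eq_zero_of_field, zero_add,
          Nat.card_eq_fintype_card, Fintype.card_coe]
    _ = ringKrullDim (MvPolynomial (Fin n) k ⧸ RingHom.ker π) :=
        (ringKrullDim_eq_of_ringEquiv (RingHom.quotientKerEquivOfSurjective hπ)).symm
    _ ≤ _ := by
        rw [ringKrullDim_quotient]
        have hsub : ∀ p ∈ PrimeSpectrum.zeroLocus (RingHom.ker π : Set (MvPolynomial (Fin n) k)),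
            p ∈ Module.support (MvPolynomial (Fin n) k) (Total M) := fun p hp =>
          (Module.mem_support_iff_exists_annihilator (M := Total M)).2
            ⟨Total.of M (sqfreeDeg F) y, hann.trans hp⟩
        exact Order.krullDim_le_of_strictMono
          (β := Module.support (MvPolynomial (Fin n) k) (Total M))
          (fun p => ⟨p.1, hsub p.1 p.2⟩) fun _ _ h => h

omit hM in
lemma ringKrullDim_quotient_span_X_le (F : Finset (Fin n)) :
    ringKrullDim (MvPolynomial (Fin n) k ⧸
      Ideal.span ((X : Fin n → MvPolynomial (Fin n) k) '' {i | i ∉ F})) ≤ F.card := by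
  set I := Ideal.span ((X : Fin n → MvPolynomial (Fin n) k) '' {i | i ∉ F})
  let f : MvPolynomial F k →ₐ[k] MvPolynomial (Fin n) k ⧸ I :=
    (Ideal.Quotient.mkₐ k I).comp (rename Subtype.val)
  have hf : Function.Surjective f := by
    rw [← AlgHom.range_eq_top, eq_top_iff, ← (AlgHom.range_eq_top _).2
      (Ideal.Quotient.mkₐ_surjective k I), ← Algebra.map_top, ← MvPolynomial.adjoin_range_X,
      AlgHom.map_adjoin, Algebra.adjoin_le_iff]
    rintro _ ⟨_, ⟨i, rfl⟩, rfl⟩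
    by_cases hi : i ∈ F
    · exact ⟨X ⟨i, hi⟩, by simp [f]⟩
    · refine ⟨0, ?_⟩
      rw [map_zero]
      have hXi : (X i : MvPolynomial (Fin n) k) ∈ I := Ideal.subset_span ⟨i, hi, rfl⟩
      exact (Ideal.Quotient.eq_zero_iff_mem.2 hXi).symm
  refine (ringKrullDim_le_of_surjective f.toRingHom hf).trans ?_
  rw [MvPolynomial.ringKrullDim_of_isNoetherianRing, ringKrullDim_eq_zero_of_field, zero_add,
    Nat.card_eq_fintype_card, Fintype.card_coe]

/-- Every chain of primes in the support lies in some `V(P_H)` with `|H| ≤ d`, where `H` consists of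
the variables outside the smallest prime of the chain. -/
lemma supportDim_le {d : ℕ} (hd : ∀ F, Nontrivial (M.obj (sqfreeDeg F)) → F.card ≤ d) :
    Module.supportDim (MvPolynomial (Fin n) k) (Total M) ≤ d := by
  refine iSup_le fun s => ?_
  let p := s.head
  obtain ⟨_, ⟨F, y, rfl⟩, hy⟩ :=
    (Module.mem_support_iff_of_span_eq_top (span_sqfree_eq_top hM)).1 p.2
  classical
  let H : Finset (Fin n) := Finset.univ.filter fun i =>
    (X i : MvPolynomial (Fin n) k) ∉ p.1.asIdeal
  have hH : H.card ≤ d := by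
    -- The prime `p` contains the annihilator of some `y ∈ M_F`. The monomial leading from `F` to `F
    -- ∪ H` involves only variables outside `p`, so it does not kill `y`, and `M_{F ∪ H} ≠ 0`.
    refine (Finset.card_le_card Finset.subset_union_right).trans (hd (F ∪ H) ?_)
    have hle : sqfreeDeg F ≤ sqfreeDeg (F ∪ H) := sqfreeDeg_mono Finset.subset_union_left
    obtain ⟨m, hm⟩ := exists_add_monDeg hle
    refine ⟨mulLE M hle y, 0, fun h0 => ?_⟩
    have hmem : monomial m (1 : k) ∈ p.1.asIdeal := by
      apply hy
      rw [Submodule.mem_annihilator_span_singleton, Total.monomial_smul, one_smul,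
        Total.of_map_congr M hm.symm _ hle]
      exact (congrArg _ h0).trans (map_zero _)
    rw [monomial_eq, C_1, one_mul, Finsupp.prod, p.1.isPrime.prod_mem_iff] at hmem
    obtain ⟨i, hi, hip⟩ := hmem
    have hiH : i ∉ H := by
      simpa [H] using p.1.isPrime.mem_of_pow_mem _ hip
    have hc := congrArg (fun a => Deg.coord a i) hm
    simp only [coord_sqfreeDeg, Finset.mem_union, hiH, or_false, Deg.coord_add, coord_monDeg] at hc
    rw [Finsupp.mem_support_iff] at hi
    lia
  have hz : ∀ i, (s i).1 ∈ PrimeSpectrum.zeroLocus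
      (Ideal.span ((X : Fin n → MvPolynomial (Fin n) k) '' {i | i ∉ H}) :
        Set (MvPolynomial (Fin n) k)) := by
    intro i
    rw [PrimeSpectrum.zeroLocus_span, PrimeSpectrum.mem_zeroLocus]
    rintro _ ⟨j, hj, rfl⟩
    have h1 : p ≤ s i := s.monotone (Fin.zero_le i)
    apply h1
    simpa [H] using hj
  let s' : LTSeries (PrimeSpectrum.zeroLocus
      (Ideal.span ((X : Fin n → MvPolynomial (Fin n) k) '' {i | i ∉ H}) :
        Set (MvPolynomial (Fin n) k))) :=
    { length := s.length
      toFun := fun i => ⟨(s i).1, hz i⟩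
      step := fun i => s.step i }
  have h1 : (s'.length : WithBot ℕ∞) ≤ _ := Order.LTSeries.length_le_krullDim s'
  rw [← ringKrullDim_quotient] at h1
  refine h1.trans ((ringKrullDim_quotient_span_X_le H).trans ?_)
  exact_mod_cast hH

/-! ### Depth and the Cohen–Macaulay property -/

lemma le_grade_of_strandExact {F : Finset (Fin n)} (hF : Nontrivial (M.obj (sqfreeDeg F)))
    {r : ℕ} (h : ∀ i < r, ∀ A, StrandExact M 0 A i) :
    (r : ℕ∞) ≤ grade (Ideal.span (Set.range (X : Fin n → MvPolynomial (Fin n) k)))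
      (Total M) := by
  have := Total.finite hM
  obtain ⟨rs, hl, hrs, hw⟩ := exists_isWeaklyRegular_of_koszulExact
    (x := (X : Fin n → MvPolynomial (Fin n) k)) r (N := Total M) fun i hi =>
      (koszulExact_total_iff i).2 ((strandExact_iff_localized hM r).2 h i hi)
  have hI : Ideal.ofList rs ≤ Ideal.span (Set.range (X : Fin n → MvPolynomial (Fin n) k)) :=
    Ideal.span_le.2 hrs
  rw [← hl]
  exact le_iSup_of_le ⟨rs, hrs, ⟨hw, top_ne_smul_top hM hF hI⟩⟩ le_rfl

lemma strandExact_of_isRegular {rs : List (MvPolynomial (Fin n) k)}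
    (hrs : ∀ r ∈ rs, r ∈ Ideal.span (Set.range (X : Fin n → MvPolynomial (Fin n) k)))
    (hreg : RingTheory.Sequence.IsRegular (Total M) rs) {i : ℕ} (hi : i < rs.length)
    (A : Finset (Fin n)) : StrandExact M 0 A i :=
  (strandExact_iff_localized hM rs.length).1 (fun _ hi' => (koszulExact_total_iff _).1
    (koszulExact_of_isWeaklyRegular hreg.toIsWeaklyRegular hrs hi')) i hi A

omit hM in
/-- The top nonzero squarefree components obstruct exactness. -/
lemma not_strandExact {F : Finset (Fin n)} (hF : Nontrivial (M.obj (sqfreeDeg F)))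
    (hmax : ∀ G, Nontrivial (M.obj (sqfreeDeg G)) → G.card ≤ F.card) :
    ¬ StrandExact M 0 F F.card := by
  intro h
  rw [← zero_add (sqfreeDeg F)] at hF
  obtain ⟨y, hy⟩ := exists_ne (0 : M.obj (0 + sqfreeDeg F))
  let z : ∀ G, M.obj (0 + sqfreeDeg G) := Function.update 0 F y
  have hzG : ∀ G, G ≠ F → z G = 0 := fun G hG => by
    simp only [z, Function.update_of_ne hG, Pi.zero_apply]
  obtain ⟨w, hw, hwz⟩ := h z
    (fun G hG => hzG G fun e => hG (by rw [e]; exact ⟨subset_rfl, rfl⟩)) (by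
      funext G
      rw [strandD]
      refine Finset.sum_eq_zero fun l hl => ?_
      by_cases hG : G.erase l = F
      · have hs : Subsingleton (M.obj (0 + sqfreeDeg G)) := by
          rw [zero_add]
          by_contra hne
          rw [not_subsingleton_iff_nontrivial] at hne
          have h1 := hmax G hne
          rw [← hG, ← Finset.card_erase_add_one hl] at h1
          lia
        exact Subsingleton.elim _ _
      · rw [hzG _ hG, map_zero, smul_zero])
  have hw0 : w = 0 := funext fun G => hw G fun hG => by
    have := Finset.card_le_card hG.1
    lia
  apply hy
  have hzF : z F = y := by simp only [z, Function.update_self]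
  rw [← hzF, ← hwz, hw0]
  simp [strandD]

/-- With `F` of maximal size among the sets with `M_F ≠ 0`, the dimension is `|F|`. Exactness below
`d` is the depth condition, exactness above `|F|` is automatic, and failure at `|F|` both forces `d
= |F|` and bounds the depth by it. -/
theorem isCohenMacaulayOfDim_iff (d : ℕ) :
    (IsCohenMacaulayOfDim M d ∨ Limits.IsZero M) ↔
      ∀ i, i ≠ d → ∀ A, StrandExact M 0 A i := by
  by_cases hZ : Limits.IsZero M
  · simp only [hZ, or_true, true_iff]
    intro i _ A z _ _
    have hs : ∀ a, Subsingleton (M.obj a) := fun a =>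
      ModuleCat.subsingleton_of_isZero ((Functor.isZero_iff M).1 hZ a)
    exact ⟨0, fun _ _ => rfl, funext fun F => Subsingleton.elim _ _⟩
  obtain ⟨a, ha⟩ : ∃ a, Nontrivial (M.obj a) := by
    by_contra! hne
    refine hZ ((Functor.isZero_iff M).2 fun a => ?_)
    exact ModuleCat.isZero_of_subsingleton _
  obtain ⟨F₀, hF₀⟩ := exists_nontrivial_sqfreeDeg hM ha
  classical
  obtain ⟨F, hF, hmax⟩ := Finset.exists_max_image
    (Finset.univ.filter fun F : Finset (Fin n) => Nontrivial (M.obj (sqfreeDeg F))) Finset.card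
    ⟨F₀, by simpa using hF₀⟩
  replace hF : Nontrivial (M.obj (sqfreeDeg F)) := by simpa using hF
  replace hmax : ∀ G, Nontrivial (M.obj (sqfreeDeg G)) → G.card ≤ F.card := fun G hG =>
    hmax G (by simpa using hG)
  have hdim : Module.supportDim (MvPolynomial (Fin n) k) (Total M) = F.card :=
    le_antisymm (supportDim_le hM hmax) (card_le_supportDim hM hF)
  have hnot := not_strandExact hF hmax
  simp only [hZ, or_false]
  constructor
  · rintro ⟨h1, h2⟩ i hi A
    rw [hdim] at h1
    have hd : F.card = d := by exact_mod_cast h1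
    rcases lt_or_gt_of_ne hi with hlt | hgt
    · have h3 : (i : ℕ∞) < grade (Ideal.span (Set.range
          (X : Fin n → MvPolynomial (Fin n) k))) (Total M) := by
        rw [h2]; exact_mod_cast hlt
      obtain ⟨⟨rs, hrs, hreg⟩, hlen⟩ := lt_iSup_iff.1 h3
      exact strandExact_of_isRegular hM hrs hreg (by exact_mod_cast hlen) A
    · intro z hz _
      have hz0 : z = 0 := funext fun G => by
        by_cases hG : G.card = i
        · have hs : Subsingleton (M.obj (0 + sqfreeDeg G)) := by
            rw [zero_add]
            by_contra hne
            rw [not_subsingleton_iff_nontrivial] at hne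
            have := hmax G hne
            lia
          exact Subsingleton.elim _ _
        · exact hz G fun h => hG h.2
      exact ⟨0, fun _ _ => rfl, by rw [hz0]; funext G; simp [strandD]⟩
  · intro h
    have hd : F.card = d := by
      by_contra hne
      exact hnot (h _ hne F)
    refine ⟨by rw [hdim, hd], le_antisymm (iSup_le ?_) ?_⟩
    · rintro ⟨rs, hrs, hreg⟩
      by_contra! hlt
      rw [← hd] at hlt
      exact hnot (strandExact_of_isRegular hM hrs hreg (by exact_mod_cast hlt) F)
    · exact le_grade_of_strandExact hM hF fun i hi => h i hi.ne

end Squarefree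

end SquarefreeMod

namespace SquarefreeMod

variable {k : Type u} [Field k] {n : ℕ} {M : GrMod k n}

/-! ### Homomorphisms into the terms of the dualizing complex -/

/-- The inclusion of faces obtained from an inequality of degrees. -/
def Face.ofLE {p : ℤ} {a b : Deg n} (h : a ≤ b) (F : Face p b) : Face p a :=
  ⟨F.1, F.2.1, (posSupp_mono h).trans F.2.2⟩

/-- `M ⟶ ω^p(a)` evaluated in degree `c` at the summand of a face. -/
def homEval {p : ℤ} {a : Deg n} (φ : M ⟶ ((shift k n).obj ((dualizing k n).X p)).obj a)
    (c : Deg n) (F : Face p (a + c)) : M.obj c →ₗ[k] k :=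
  (LinearMap.proj (R := k) (φ := fun _ : Face p (a + c) => k) F) ∘ₗ (φ.app c).hom

lemma add_le_add_deg (a : Deg n) {c c' : Deg n} (h : c ≤ c') : a + c ≤ a + c' :=
  Deg.le_def.2 fun i => by
    have := Deg.le_def.1 h i
    simpa using this

lemma homEval_mulLE {p : ℤ} {a : Deg n}
    (φ : M ⟶ ((shift k n).obj ((dualizing k n).X p)).obj a) {c c' : Deg n} (h : c ≤ c')
    (F : Face p (a + c')) (y : M.obj c) :
    homEval φ c' F (mulLE M h y) = homEval φ c (F.ofLE (add_le_add_deg a h)) y :=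
  congrFun (mulLE_naturality φ h y) F

lemma hom_ext_homEval {p : ℤ} {a : Deg n}
    {φ ψ : M ⟶ ((shift k n).obj ((dualizing k n).X p)).obj a}
    (h : ∀ c F y, homEval φ c F y = homEval ψ c F y) : φ = ψ := by
  ext c y
  funext F
  exact h c F y

lemma dualizing_d_apply {p q : ℤ} (h : p + 1 = q) (a : Deg n) (f : Face p a → k)
    (G : Face q a) :
    (((dualizing k n).d p q).app a).hom f G = ∑ j : {j // j ∉ G.1},
      sgn k j.1 (insert j.1 G.1) * f ⟨insert j.1 G.1, by
        rw [Finset.card_insert_of_notMem j.2]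
        have := G.2.1
        push_cast
        lia, G.2.2.trans (Finset.subset_insert _ _)⟩ := by
  subst h
  have : (dualizing k n).d p (p + 1) = dualizingD k n p :=
    CochainComplex.of_d (dualizingObj k n) (dualizingD k n) p
  rw [this]
  rfl

lemma sgn_eq_isgn (j : Fin n) (F : Finset (Fin n)) : sgn k j F = ((isgn j F : ℤ) : k) := by
  simp [sgn, isgn]

/-- The degrees at which homomorphisms into `*E(S/P_F)(a)` are determined. -/
def IsCorner (a : Deg n) (F : Finset (Fin n)) (c : Deg n) : Prop :=
  ∀ i, (i ∈ F → 1 ≤ c.coord i) ∧ (i ∉ F → a.coord i + c.coord i = 0)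

lemma IsCorner.posSupp_subset {a c : Deg n} {F : Finset (Fin n)} (h : IsCorner a F c) :
    posSupp (a + c) ⊆ F := fun i hi => by
  by_contra hF
  rw [mem_posSupp, Deg.coord_add, (h i).2 hF] at hi
  exact lt_irrefl _ hi

/-- The coordinatewise maximum. -/
def Deg.max (b c : Deg n) : Deg n := fun i => Max.max (b.coord i) (c.coord i)

@[simp] lemma Deg.coord_max (b c : Deg n) (i : Fin n) :
    (b.max c).coord i = Max.max (b.coord i) (c.coord i) := rfl

lemma Deg.le_max_left (b c : Deg n) : b ≤ b.max c := Deg.le_def.2 fun _ => _root_.le_max_left _ _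
lemma Deg.le_max_right (b c : Deg n) : c ≤ b.max c := Deg.le_def.2 fun _ => _root_.le_max_right _ _

section Squarefree

variable (hM : IsSquarefree M)

include hM

/-- Off `F` the corner already has the largest coordinates at which `*E(S/P_F)(a)` is nonzero, so
`d` can exceed `c` only in coordinates from `F`, where `c` is positive. -/
lemma bijective_of_isCorner {a b c d : Deg n} {F : Finset (Fin n)} (hc : IsCorner a F c)
    (hcd : c ≤ d) (hd : ∀ i ∉ F, d.coord i ≤ Max.max (b.coord i) (c.coord i))
    (hb : posSupp (a + b) ⊆ F) : Function.Bijective (mulLE M hcd) := by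
  refine mulLE_bijective hM _ fun i hi => ?_
  by_cases hF : i ∈ F
  · have := (hc i).1 hF; lia
  · exfalso
    apply hi
    have h1 := (hc i).2 hF
    have h2 := hd i hF
    have h3 := Deg.le_def.1 hcd i
    have h4 : ¬ 0 < (a + b).coord i := fun h => hF (hb (mem_posSupp.2 h))
    rw [Deg.coord_add] at h4
    lia

/-- The map `M_b → M_c` to a corner. -/
def toCorner {a b c : Deg n} {F : Finset (Fin n)} (hc : IsCorner a F c)
    (hb : posSupp (a + b) ⊆ F) : M.obj b →ₗ[k] M.obj c :=
  (LinearEquiv.ofBijective (mulLE M (b.le_max_right c))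
    (bijective_of_isCorner hM (b := b) hc _ (fun _ _ => le_rfl) hb)).symm.toLinearMap ∘ₗ
    mulLE M (b.le_max_left c)

lemma mulLE_toCorner {a b c : Deg n} {F : Finset (Fin n)} (hc : IsCorner a F c)
    (hb : posSupp (a + b) ⊆ F) {d : Deg n} (hbd : b ≤ d) (hcd : c ≤ d) (y : M.obj b) :
    mulLE M hcd (toCorner hM hc hb y) = mulLE M hbd y := by
  have h : mulLE M (b.le_max_right c) (toCorner hM hc hb y) = mulLE M (b.le_max_left c) y :=
    (LinearEquiv.ofBijective (mulLE M (b.le_max_right c))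
      (bijective_of_isCorner hM hc _ (fun _ _ => le_rfl) hb)).apply_symm_apply _
  have hd : b.max c ≤ d := Deg.le_def.2 fun i =>
    _root_.max_le (Deg.le_def.1 hbd i) (Deg.le_def.1 hcd i)
  rw [← mulLE_mulLE M (b.le_max_right c) hd, h, mulLE_mulLE]

lemma toCorner_mulLE {a b b' c : Deg n} {F : Finset (Fin n)} (hc : IsCorner a F c)
    (hbb : b ≤ b') (hb : posSupp (a + b) ⊆ F) (hb' : posSupp (a + b') ⊆ F) (y : M.obj b) :
    toCorner hM hc hb' (mulLE M hbb y) = toCorner hM hc hb y := by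
  apply (bijective_of_isCorner hM (b := b') hc (b'.le_max_right c) (fun _ _ => le_rfl) hb').1
  rw [mulLE_toCorner hM hc hb' (b'.le_max_left c), mulLE_mulLE,
    mulLE_toCorner hM hc hb (hbb.trans (b'.le_max_left c))]

lemma toCorner_self {a c : Deg n} {F : Finset (Fin n)} (hc : IsCorner a F c) (y : M.obj c) :
    toCorner hM hc hc.posSupp_subset y = y := by
  apply (bijective_of_isCorner hM (b := c) hc (c.le_max_right c) (fun _ _ => le_rfl)
    hc.posSupp_subset).1
  rw [mulLE_toCorner hM hc hc.posSupp_subset (c.le_max_left c)]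

lemma homEval_eq_toCorner {p : ℤ} {a : Deg n}
    (φ : M ⟶ ((shift k n).obj ((dualizing k n).X p)).obj a) {b c : Deg n} (F : Face p (a + b))
    (hc : IsCorner a F.1 c) (y : M.obj b) :
    homEval φ b F y =
      homEval φ c ⟨F.1, F.2.1, hc.posSupp_subset⟩ (toCorner hM hc F.2.2 y) := by
  have hd : posSupp (a + b.max c) ⊆ F.1 := fun i hi => by
    by_contra hF
    rw [mem_posSupp, Deg.coord_add, Deg.coord_max] at hi
    have h1 := (hc i).2 hF
    have h2 : ¬ 0 < (a + b).coord i := fun h => hF (F.2.2 (mem_posSupp.2 h))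
    rw [Deg.coord_add] at h2
    lia
  have h := mulLE_toCorner hM hc F.2.2 (b.le_max_left c) (b.le_max_right c) y
  let F' : Face p (a + b.max c) := ⟨F.1, F.2.1, hd⟩
  exact (homEval_mulLE φ (b.le_max_left c) F' y).symm.trans
    ((congrArg (homEval φ (b.max c) F') h).symm.trans (homEval_mulLE φ _ F' _))

/-- A homomorphism to `ω^p(a)` is determined by its values at corners. -/
lemma hom_ext_corner {p : ℤ} {a : Deg n} (c : Face p a → Deg n)
    (hc : ∀ F, IsCorner a F.1 (c F))
    {φ ψ : M ⟶ ((shift k n).obj ((dualizing k n).X p)).obj a}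
    (h : ∀ F y, homEval φ (c F) ⟨F.1, F.2.1, (hc F).posSupp_subset⟩ y =
      homEval ψ (c F) ⟨F.1, F.2.1, (hc F).posSupp_subset⟩ y) : φ = ψ := by
  refine hom_ext_homEval fun b F y => ?_
  -- If `b ≥ 0`, a face for `a + b` is also a face for `a`, so a corner has been prescribed for it;
  -- otherwise `M_b = 0`.
  by_cases hb : 0 ≤ b
  · have ha : posSupp a ⊆ F.1 := (posSupp_mono (by
      have := add_le_add_deg a hb
      rwa [add_zero] at this)).trans F.2.2
    have hcF : IsCorner a F.1 (c ⟨F.1, F.2.1, ha⟩) := hc ⟨F.1, F.2.1, ha⟩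
    rw [homEval_eq_toCorner hM φ F hcF, homEval_eq_toCorner hM ψ F hcF]
    exact h ⟨F.1, F.2.1, ha⟩ _
  · have := hM.subsingleton b hb
    rw [Subsingleton.elim y 0, map_zero, map_zero]

/-- Values at corners can be prescribed. -/
lemma exists_hom_corner {p : ℤ} {a : Deg n} (c : Face p a → Deg n)
    (hc : ∀ F, IsCorner a F.1 (c F)) (ψ : ∀ F, M.obj (c F) →ₗ[k] k) :
    ∃ φ : M ⟶ ((shift k n).obj ((dualizing k n).X p)).obj a,
      ∀ F y, homEval φ (c F) ⟨F.1, F.2.1, (hc F).posSupp_subset⟩ y = ψ F y := by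
  classical
  -- The default value `0` loses nothing: if `supp₊(a + b) ⊆ F` but `supp₊(a) ⊄ F`, then `b` has a
  -- negative coordinate and `M_b = 0`.
  let val : ∀ b (F : Face p (a + b)), M.obj b →ₗ[k] k := fun b F =>
    if h : posSupp a ⊆ F.1 then
      ψ ⟨F.1, F.2.1, h⟩ ∘ₗ toCorner hM (hc ⟨F.1, F.2.1, h⟩) F.2.2
    else 0
  refine ⟨{ app := fun b => ModuleCat.ofHom (LinearMap.pi fun F => val b F)
            naturality := fun b b' f => ?_ }, fun F y => ?_⟩
  · ext y
    funext F
    change val b' F (mulLE M (leOfHom f) y) = val b (F.ofLE (add_le_add_deg a (leOfHom f))) y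
    by_cases h : posSupp a ⊆ F.1
    · have h' : posSupp a ⊆ (F.ofLE (add_le_add_deg a (leOfHom f))).1 := h
      simp only [val]
      rw [dif_pos h, dif_pos h', LinearMap.comp_apply, LinearMap.comp_apply, toCorner_mulLE]
      rfl
    · have h' : ¬ posSupp a ⊆ (F.ofLE (add_le_add_deg a (leOfHom f))).1 := h
      simp only [val]
      rw [dif_neg h, dif_neg h']
      rfl
  · change val (c F) _ y = ψ F y
    have h : posSupp a ⊆ F.1 := F.2.2
    simp only [val]
    rw [dif_pos h, LinearMap.comp_apply]
    exact congrArg (ψ F) (toCorner_self hM (hc F) y)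

end Squarefree

end SquarefreeMod

namespace SquarefreeMod

variable {k : Type u} [Field k] {n : ℕ} {M : GrMod k n}

/-! ### Duality between strands and homomorphisms into the dualizing complex -/

/-- The coordinatewise negative part of a degree. -/
def negPart (a : Deg n) : Deg n := fun i => max 0 (-a.coord i)

@[simp] lemma coord_negPart (a : Deg n) (i : Fin n) :
    (negPart a).coord i = max 0 (-a.coord i) := rfl

/-- One base degree `a⁻` serves all faces at once, so the components of `M` at these corners are
those of a single Koszul strand. -/
lemma isCorner_negPart {a : Deg n} {F : Finset (Fin n)} (hF : posSupp a ⊆ F) :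
    IsCorner a F (negPart a + sqfreeDeg F) := fun i => by
  have : i ∉ F → ¬ 0 < a.coord i := fun h h' => h (hF (mem_posSupp.2 h'))
  simp only [Deg.coord_add, coord_negPart, coord_sqfreeDeg]
  split_ifs with h
  · exact ⟨fun _ => by lia, fun h' => absurd h h'⟩
  · exact ⟨fun h' => absurd h' h, fun _ => by have := this h; lia⟩

variable (M) in
/-- The differential of a strand, as a linear map. -/
def strandL (b : Deg n) : (∀ F, M.obj (b + sqfreeDeg F)) →ₗ[k] ∀ F, M.obj (b + sqfreeDeg F) where
  toFun := strandD M b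
  map_add' := strandD_add M b
  map_smul' c z := by
    funext F
    simp only [strandD, Pi.smul_apply, map_smul, RingHom.id_apply, Finset.smul_sum]
    exact Finset.sum_congr rfl fun l _ => smul_comm _ _ _

variable (M) in
/-- The families supported on the index sets with property `P`. -/
def strandSupp (b : Deg n) (P : Finset (Fin n) → Prop) :
    Submodule k (∀ F, M.obj (b + sqfreeDeg F)) where
  carrier := {z | ∀ F, ¬ P F → z F = 0}
  add_mem' hx hy F hF := by rw [Pi.add_apply, hx F hF, hy F hF, add_zero]
  zero_mem' _ _ := rfl
  smul_mem' c x hx F hF := by rw [Pi.smul_apply, hx F hF, smul_zero]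

open Classical in
/-- The value of `φ : M ⟶ ω^p(a)` on the component of a strand indexed by `F`; it is zero if
`F` is not a face. -/
def faceEval {p : ℤ} {a : Deg n} (φ : M ⟶ ((shift k n).obj ((dualizing k n).X p)).obj a)
    (F : Finset (Fin n)) : M.obj (negPart a + sqfreeDeg F) →ₗ[k] k :=
  if h : (F.card : ℤ) = -p ∧ posSupp a ⊆ F then
    homEval φ (negPart a + sqfreeDeg F) ⟨F, h.1, (isCorner_negPart h.2).posSupp_subset⟩
  else 0

lemma faceEval_pos {p : ℤ} {a : Deg n}
    (φ : M ⟶ ((shift k n).obj ((dualizing k n).X p)).obj a) {F : Finset (Fin n)}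
    (h : (F.card : ℤ) = -p ∧ posSupp a ⊆ F) :
    faceEval φ F =
      homEval φ (negPart a + sqfreeDeg F) ⟨F, h.1, (isCorner_negPart h.2).posSupp_subset⟩ :=
  dif_pos h

lemma faceEval_neg {p : ℤ} {a : Deg n}
    (φ : M ⟶ ((shift k n).obj ((dualizing k n).X p)).obj a) {F : Finset (Fin n)}
    (h : ¬ ((F.card : ℤ) = -p ∧ posSupp a ⊆ F)) : faceEval φ F = 0 :=
  dif_neg h

/-- The pairing of `Hom(M, ω^p(a))` with strands. -/
def homPair {p : ℤ} {a : Deg n} (φ : M ⟶ ((shift k n).obj ((dualizing k n).X p)).obj a) :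
    (∀ F, M.obj (negPart a + sqfreeDeg F)) →ₗ[k] k :=
  ∑ F, faceEval φ F ∘ₗ LinearMap.proj F

lemma homPair_apply {p : ℤ} {a : Deg n}
    (φ : M ⟶ ((shift k n).obj ((dualizing k n).X p)).obj a)
    (z : ∀ F, M.obj (negPart a + sqfreeDeg F)) : homPair φ z = ∑ F, faceEval φ F (z F) := by
  simp [homPair]

lemma homPair_single {p : ℤ} {a : Deg n}
    (φ : M ⟶ ((shift k n).obj ((dualizing k n).X p)).obj a) (F : Finset (Fin n))
    (y : M.obj (negPart a + sqfreeDeg F)) :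
    homPair φ (LinearMap.single k (fun F => M.obj (negPart a + sqfreeDeg F)) F y) =
      faceEval φ F y := by
  rw [homPair_apply, Finset.sum_eq_single_of_mem F (Finset.mem_univ F)]
  · rw [LinearMap.single_apply, Pi.single_eq_same]
  · intro G _ hG
    rw [LinearMap.single_apply, Pi.single_eq_of_ne hG, map_zero]

variable (k) in
/-- The differential of the complex `ω^•(a)`. -/
abbrev shiftD (a : Deg n) (p q : ℤ) :
    ((shift k n).obj ((dualizing k n).X p)).obj a ⟶ ((shift k n).obj ((dualizing k n).X q)).obj a :=
  ((shift k n).map ((dualizing k n).d p q)).app a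

lemma homEval_comp {p q : ℤ} (h : p + 1 = q) {a : Deg n}
    (φ : M ⟶ ((shift k n).obj ((dualizing k n).X p)).obj a) (c : Deg n) (G : Face q (a + c))
    (y : M.obj c) :
    homEval (φ ≫ shiftD k a p q) c G y = ∑ j : {j // j ∉ G.1},
      sgn k j.1 (insert j.1 G.1) * homEval φ c ⟨insert j.1 G.1, by
        rw [Finset.card_insert_of_notMem j.2]
        have := G.2.1
        push_cast
        lia, G.2.2.trans (Finset.subset_insert _ _)⟩ y :=
  dualizing_d_apply h (a + c) _ G

lemma faceEval_comp {p q : ℤ} (h : p + 1 = q) {a : Deg n}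
    (φ : M ⟶ ((shift k n).obj ((dualizing k n).X p)).obj a) {G : Finset (Fin n)}
    (hG : posSupp a ⊆ G) (y : M.obj (negPart a + sqfreeDeg G)) :
    faceEval (φ ≫ shiftD k a p q) G y = ∑ j ∈ Gᶜ, isgn j (insert j G) •
      faceEval φ (insert j G) (mulLE M (add_sqfreeDeg_le _ (Finset.subset_insert j G)) y) := by
  by_cases hq : (G.card : ℤ) = -q
  · rw [faceEval_pos _ ⟨hq, hG⟩, Finset.sum_subtype Gᶜ (fun j => Finset.mem_compl)]
    refine (homEval_comp h φ _ _ y).trans (Finset.sum_congr rfl fun j _ => ?_)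
    have hj : ((insert j.1 G).card : ℤ) = -p ∧ posSupp a ⊆ insert j.1 G := by
      rw [Finset.card_insert_of_notMem j.2]
      push_cast
      exact ⟨by lia, hG.trans (Finset.subset_insert _ _)⟩
    rw [sgn_eq_isgn, zsmul_eq_mul, faceEval_pos _ hj]
    congr 1
    exact (homEval_mulLE φ (add_sqfreeDeg_le _ (Finset.subset_insert j.1 G))
      ⟨insert j.1 G, hj.1, (isCorner_negPart hj.2).posSupp_subset⟩ y).symm
  · rw [faceEval_neg _ fun h => hq h.1, Finset.sum_eq_zero]
    · rfl
    · intro j hj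
      rw [faceEval_neg, LinearMap.zero_apply, smul_zero]
      rw [Finset.card_insert_of_notMem (Finset.mem_compl.1 hj)]
      push_cast
      rintro ⟨h1, -⟩
      lia

/-- The differential of `Hom(M, ω^•(a))` is the transpose of the Koszul differential: pairs `(G, j)`
with `j ∉ G` correspond to pairs `(G ∪ {j}, j)`, with the same sign. -/
lemma homPair_comp {p q : ℤ} (h : p + 1 = q) {a : Deg n}
    (φ : M ⟶ ((shift k n).obj ((dualizing k n).X p)).obj a)
    (z : ∀ F, M.obj (negPart a + sqfreeDeg F)) (hz : ∀ F, ¬ posSupp a ⊆ F → z F = 0) :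
    homPair (φ ≫ shiftD k a p q) z = homPair φ (strandD M (negPart a) z) := by
  have h1 : ∀ G, faceEval (φ ≫ shiftD k a p q) G (z G) =
      ∑ j ∈ Gᶜ, isgn j (insert j G) • faceEval φ (insert j G)
        (mulLE M (add_sqfreeDeg_le _ (Finset.subset_insert j G)) (z G)) := by
    intro G
    by_cases hG : posSupp a ⊆ G
    · exact faceEval_comp h φ hG (z G)
    · simp [hz G hG]
  simp only [homPair_apply, h1, strandD, map_sum, map_zsmul]
  rw [Finset.sum_sigma', Finset.sum_sigma']
  refine Finset.sum_bij' (fun x _ => ⟨insert x.2 x.1, x.2⟩) (fun x _ => ⟨x.1.erase x.2, x.2⟩)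
    ?_ ?_ ?_ ?_ ?_
  · rintro ⟨G, j⟩ hx
    simp
  · rintro ⟨G, j⟩ hx
    simp
  · rintro ⟨G, j⟩ hx
    simp only [Finset.mem_sigma, Finset.mem_univ, Finset.mem_compl, true_and] at hx
    simp [Finset.erase_insert hx]
  · rintro ⟨G, j⟩ hx
    simp only [Finset.mem_sigma, Finset.mem_univ, true_and] at hx
    simp [Finset.insert_erase hx]
  · rintro ⟨G, j⟩ hx
    simp only [Finset.mem_sigma, Finset.mem_univ, Finset.mem_compl, true_and] at hx
    dsimp only
    congr 2
    exact mulLE_congr M z (Finset.erase_insert hx).symm _ _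

section Squarefree

variable (hM : IsSquarefree M)

include hM

lemma hom_ext_faceEval {p : ℤ} {a : Deg n}
    {φ ψ : M ⟶ ((shift k n).obj ((dualizing k n).X p)).obj a}
    (h : ∀ F, (F.card : ℤ) = -p ∧ posSupp a ⊆ F → faceEval φ F = faceEval ψ F) : φ = ψ := by
  refine hom_ext_corner hM (fun F => negPart a + sqfreeDeg F.1) (fun F => isCorner_negPart F.2.2)
    fun F y => ?_
  have := h F.1 F.2
  rw [faceEval_pos _ F.2, faceEval_pos _ F.2] at this
  exact LinearMap.congr_fun this y

lemma exists_hom_faceEval (p : ℤ) {a : Deg n}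
    (ψ : ∀ F, M.obj (negPart a + sqfreeDeg F) →ₗ[k] k) :
    ∃ φ : M ⟶ ((shift k n).obj ((dualizing k n).X p)).obj a,
      ∀ F, (F.card : ℤ) = -p ∧ posSupp a ⊆ F → faceEval φ F = ψ F := by
  obtain ⟨φ, hφ⟩ := exists_hom_corner hM (p := p) (a := a) (fun F => negPart a + sqfreeDeg F.1)
    (fun F => isCorner_negPart F.2.2) (fun F => ψ F.1)
  refine ⟨φ, fun F hF => ?_⟩
  rw [faceEval_pos _ hF]
  exact LinearMap.ext fun y => hφ ⟨F, hF⟩ y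

lemma exists_homPair_eq (p : ℤ) {a : Deg n}
    (μ : (∀ F, M.obj (negPart a + sqfreeDeg F)) →ₗ[k] k) :
    ∃ φ : M ⟶ ((shift k n).obj ((dualizing k n).X p)).obj a,
      ∀ z ∈ strandSupp M (negPart a) (fun F => posSupp a ⊆ F ∧ (F.card : ℤ) = -p),
        homPair φ z = μ z := by
  obtain ⟨φ, hφ⟩ := exists_hom_faceEval hM p
    fun F => μ ∘ₗ LinearMap.single k (fun F => M.obj (negPart a + sqfreeDeg F)) F
  refine ⟨φ, fun z hz => ?_⟩
  rw [homPair_apply]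
  have hsum : z = ∑ F, LinearMap.single k (fun F => M.obj (negPart a + sqfreeDeg F)) F (z F) :=
    (Finset.univ_sum_single z).symm
  conv_rhs => rw [hsum, map_sum]
  refine Finset.sum_congr rfl fun F _ => ?_
  by_cases hF : (F.card : ℤ) = -p ∧ posSupp a ⊆ F
  · rw [hφ F hF]
    rfl
  · rw [hz F fun h => hF h.symm, map_zero, map_zero, map_zero]

/-- Exactness of `Hom(M, ω^•(a))` is dual to exactness of a strand. -/
theorem homExact_iff (a : Deg n) {p q r : ℤ} (hpq : p + 1 = q) (hqr : q + 1 = r) {i : ℕ}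
    (hi : q = -i) :
    (∀ φ : M ⟶ ((shift k n).obj ((dualizing k n).X q)).obj a, φ ≫ shiftD k a q r = 0 →
      ∃ χ : M ⟶ ((shift k n).obj ((dualizing k n).X p)).obj a, χ ≫ shiftD k a p q = φ) ↔
    StrandExact M (negPart a) (posSupp a) i := by
  have hcard : ∀ F : Finset (Fin n), (F.card : ℤ) = -q ↔ F.card = i := fun F => by lia
  have hcard' : ∀ F : Finset (Fin n), (F.card : ℤ) = -r ↔ F.card + 1 = i := fun F => by lia
  constructor
  · intro H z hz hdz
    by_contra hne
    let Z' := (strandSupp M (negPart a) fun F => posSupp a ⊆ F ∧ F.card + 1 = i).map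
      (strandL M (negPart a))
    have hzZ : z ∉ Z' := fun ⟨w, hw, hwz⟩ => hne ⟨w, hw, hwz⟩
    -- A cocycle `z` that is not a coboundary is separated from the coboundaries by a functional
    -- `μ`. The map representing `μ` is a cocycle, hence a coboundary by hypothesis, and therefore
    -- vanishes on `z`: a contradiction.
    obtain ⟨μ, hμz, hμ⟩ := Submodule.exists_le_ker_of_notMem hzZ
    obtain ⟨φ, hφ⟩ := exists_homPair_eq hM q μ
    have hφd : φ ≫ shiftD k a q r = 0 := by
      refine hom_ext_faceEval hM fun F hF => LinearMap.ext fun y => ?_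
      rw [← homPair_single, homPair_comp hqr]
      · rw [hφ]
        · have h0 : μ (strandL M (negPart a)
              (LinearMap.single k (fun F => M.obj (negPart a + sqfreeDeg F)) F y)) = 0 := by
            refine hμ (Submodule.mem_map_of_mem fun G hG => ?_)
            rw [LinearMap.single_apply, Pi.single_eq_of_ne]
            rintro rfl
            exact hG ⟨hF.2, (hcard' G).1 hF.1⟩
          refine h0.trans ?_
          rw [faceEval_pos _ hF]
          rfl
        · intro G hG
          rw [strandD]
          refine Finset.sum_eq_zero fun l hl => ?_
          rw [LinearMap.single_apply, Pi.single_eq_of_ne, map_zero, smul_zero]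
          rintro rfl
          have h1 := (hcard' _).1 hF.1
          rw [Finset.card_erase_add_one hl] at h1
          exact hG ⟨hF.2.trans (Finset.erase_subset _ _), (hcard G).2 h1⟩
      · intro G hG
        rw [LinearMap.single_apply, Pi.single_eq_of_ne]
        rintro rfl
        exact hG hF.2
    obtain ⟨χ, rfl⟩ := H φ hφd
    apply hμz
    rw [← hφ z fun F hF => hz F fun h => hF ⟨h.1, (hcard F).2 h.2⟩,
      homPair_comp hpq _ _ fun F hF => hz F fun h => hF h.1, hdz, map_zero]
  · intro H φ hφ
    let Zi := strandSupp M (negPart a) fun F => posSupp a ⊆ F ∧ F.card = i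
    let D : Zi →ₗ[k] ∀ F, M.obj (negPart a + sqfreeDeg F) := strandL M (negPart a) ∘ₗ Zi.subtype
    -- By exactness the kernel of `D` consists of coboundaries, which `φ` kills; a functional
    -- vanishing on `ker D` factors through `D`.
    have hmem : homPair φ ∘ₗ Zi.subtype ∈ LinearMap.range D.dualMap := by
      rw [LinearMap.range_dualMap_eq_dualAnnihilator_ker, Submodule.mem_dualAnnihilator]
      rintro ⟨z, hz⟩ hdz
      obtain ⟨w, hw, rfl⟩ := H z hz hdz
      change homPair φ (strandD M (negPart a) w) = 0
      rw [← homPair_comp hqr φ w fun F hF => hw F fun h => hF h.1, hφ, homPair_apply]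
      refine Finset.sum_eq_zero fun F _ => ?_
      by_cases hF : (F.card : ℤ) = -r ∧ posSupp a ⊆ F
      · rw [faceEval_pos _ hF]
        rfl
      · rw [faceEval_neg _ hF]
        rfl
    obtain ⟨μ, hμ⟩ := hmem
    obtain ⟨χ, hχ⟩ := exists_homPair_eq hM p μ
    refine ⟨χ, hom_ext_faceEval hM fun F hF => LinearMap.ext fun y => ?_⟩
    have hsF : ∀ G, G ≠ F →
        LinearMap.single k (fun F => M.obj (negPart a + sqfreeDeg F)) F y G = 0 := fun G hG => by
      rw [LinearMap.single_apply, Pi.single_eq_of_ne hG]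
    have hs : LinearMap.single k (fun F => M.obj (negPart a + sqfreeDeg F)) F y ∈ Zi :=
      fun G hG => hsF G (by rintro rfl; exact hG ⟨hF.2, (hcard G).1 hF.1⟩)
    rw [← homPair_single, ← homPair_single, homPair_comp hpq _ _ fun G hG => hsF G (by
      rintro rfl; exact hG hF.2), hχ]
    · exact LinearMap.congr_fun hμ ⟨_, hs⟩
    · intro G hG
      rw [strandD]
      refine Finset.sum_eq_zero fun l hl => ?_
      rw [hsF, map_zero, smul_zero]
      rintro rfl
      have h1 := (hcard _).1 hF.1
      have h2 := Finset.card_erase_add_one hl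
      exact hG ⟨hF.2.trans (Finset.erase_subset _ _), by lia⟩

end Squarefree

end SquarefreeMod

namespace SquarefreeMod

variable {k : Type u} [Field k] {n : ℕ}

/-! ### Injectivity of the terms of the dualizing complex -/

section Injective

/-- The degrees in which `*E(S/P_F)(a)` is nonzero. -/
abbrev DegBelow (a : Deg n) (F : Finset (Fin n)) : Type := {b : Deg n // posSupp (a + b) ⊆ F}

instance (a : Deg n) (F : Finset (Fin n)) : Nonempty (DegBelow a F) :=
  ⟨⟨-a, by
    intro i hi
    rw [mem_posSupp, Deg.coord_add, Deg.coord_neg, add_neg_cancel] at hi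
    exact absurd hi (lt_irrefl _)⟩⟩

instance (a : Deg n) (F : Finset (Fin n)) : IsDirectedOrder (DegBelow a F) :=
  ⟨fun b c => ⟨⟨b.1.max c.1, fun i hi => by
    rw [mem_posSupp, Deg.coord_add, Deg.coord_max] at hi
    rcases max_choice (b.1.coord i) (c.1.coord i) with h | h
    · exact b.2 (mem_posSupp.2 (by rwa [h] at hi))
    · exact c.2 (mem_posSupp.2 (by rwa [h] at hi))⟩,
    b.1.le_max_left c.1, b.1.le_max_right c.1⟩⟩

variable (X : GrMod k n)

instance (a : Deg n) (F : Finset (Fin n)) : DirectedSystem (fun b : DegBelow a F => X.obj b.1)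
    (fun _ _ h => mulLE X h) where
  map_self _ _ := mulLE_refl X _ _
  map_map _ _ _ _ _ _ := mulLE_mulLE X _ _ _

/-- Compatible functionals on the components `X_b` with `supp₊(a + b) ⊆ F` extend along
monomorphisms. -/
lemma exists_extend_compatible {X Y : GrMod k n} (f : X ⟶ Y) [Mono f] (a : Deg n)
    (F : Finset (Fin n)) (g : ∀ b : DegBelow a F, X.obj b.1 →ₗ[k] k)
    (hg : ∀ (b c : DegBelow a F) (h : b ≤ c) (x : X.obj b.1), g c (mulLE X h x) = g b x) :
    ∃ g' : ∀ b : DegBelow a F, Y.obj b.1 →ₗ[k] k,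
      (∀ (b c : DegBelow a F) (h : b ≤ c) (y : Y.obj b.1), g' c (mulLE Y h y) = g' b y) ∧
      ∀ (b : DegBelow a F) (x : X.obj b.1), g' b ((f.app b.1).hom x) = g b x := by
  -- Compatible families are the functionals on the direct limit. The limit is directed, so it
  -- preserves injectivity, and functionals extend over a field.
  let LX := Module.DirectLimit (R := k) (fun b : DegBelow a F => X.obj b.1)
    (fun _ _ h => mulLE X h)
  let LY := Module.DirectLimit (R := k) (fun b : DegBelow a F => Y.obj b.1)
    (fun _ _ h => mulLE Y h)
  let γ : LX →ₗ[k] k := Module.DirectLimit.lift k _ _ _ g hg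
  let ι : LX →ₗ[k] LY := Module.DirectLimit.map (fun b => (f.app b.1).hom) fun b c h => by
    ext x
    exact mulLE_naturality f h x
  have hι : Function.Injective ι := by
    rw [injective_iff_map_eq_zero]
    intro t ht
    obtain ⟨b, x, rfl⟩ := Module.DirectLimit.exists_of t
    rw [Module.DirectLimit.map_apply_of] at ht
    obtain ⟨c, h, hc⟩ := Module.DirectLimit.of.zero_exact ht
    rw [← mulLE_naturality] at hc
    have hinj : Function.Injective (f.app c.1) :=
      (ModuleCat.mono_iff_injective _).1 inferInstance
    have hx : mulLE X h x = 0 := hinj (hc.trans (map_zero _).symm)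
    rw [← Module.DirectLimit.of_f (hij := h), hx, map_zero]
  obtain ⟨γ', hγ'⟩ := LinearMap.dualMap_surjective_of_injective hι γ
  refine ⟨fun b => γ' ∘ₗ Module.DirectLimit.of k (DegBelow a F) (fun b => Y.obj b.1)
    (fun _ _ h => mulLE Y h) b, fun b c h y => ?_, fun b x => ?_⟩
  · exact congrArg γ' (Module.DirectLimit.of_f (hij := h))
  · have h1 := LinearMap.congr_fun hγ' (Module.DirectLimit.of k _ _ _ b x)
    rw [LinearMap.dualMap_apply, Module.DirectLimit.map_apply_of] at h1
    exact h1.trans (Module.DirectLimit.lift_of _ _ _)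

/-- A map to `ω^p(a)` is an independent choice, for each `F` with `|F| = -p`, of compatible
functionals on the degrees below `F`; each choice is extended separately. -/
instance injective_shift_dualizing (p : ℤ) (a : Deg n) :
    Injective (((shift k n).obj ((dualizing k n).X p)).obj a) where
  factors {X Y} g f _ := by
    have h : ∀ F : Finset (Fin n), ∃ g' : ∀ b : DegBelow a F, Y.obj b.1 →ₗ[k] k,
        (∀ (b c : DegBelow a F) (h : b ≤ c) (y : Y.obj b.1), g' c (mulLE Y h y) = g' b y) ∧
        ∀ (hF : (F.card : ℤ) = -p) (b : DegBelow a F) (x : X.obj b.1),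
          g' b ((f.app b.1).hom x) = homEval g b.1 ⟨F, hF, b.2⟩ x := fun F => by
      by_cases hF : (F.card : ℤ) = -p
      · obtain ⟨g', h1, h2⟩ := exists_extend_compatible f a F
          (fun b => homEval g b.1 ⟨F, hF, b.2⟩)
          (fun b c h x => homEval_mulLE g h (⟨F, hF, c.2⟩ : Face p (a + c.1)) x)
        exact ⟨g', h1, fun _ => h2⟩
      · exact ⟨0, fun _ _ _ _ => rfl, fun hF' => absurd hF' hF⟩
    choose g' h1 h2 using h
    refine ⟨{ app := fun b => ModuleCat.ofHom
                (LinearMap.pi fun G : Face p (a + b) => g' G.1 ⟨b, G.2.2⟩)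
              naturality := fun b c m => ?_ }, ?_⟩
    · ext y
      funext G
      exact h1 G.1 ⟨b, (posSupp_mono (add_le_add_deg a (leOfHom m))).trans G.2.2⟩ ⟨c, G.2.2⟩
        (leOfHom m) y
    · ext b x
      funext G
      exact h2 G.1 G.2.1 ⟨b, G.2.2⟩ x

end Injective

/-! ### Exactness of the dualizing complex -/

lemma Face.isEmpty_of_pos {p : ℤ} (hp : 0 < p) (c : Deg n) : IsEmpty (Face p c) :=
  ⟨fun F => by have := F.2.1; lia⟩

lemma Face.isEmpty_of_lt {p : ℤ} (hp : p < -n) (c : Deg n) : IsEmpty (Face p c) :=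
  ⟨fun F => by
    have h1 := F.2.1
    have h2 := Finset.card_le_univ F.1
    rw [Fintype.card_fin] at h2
    lia⟩

/-- The differential of the dualizing complex in terms of extensions by zero. -/
lemma dualizing_d_apply' {p q : ℤ} (h : p + 1 = q) (c : Deg n) (f : Face p c → k)
    (e : Finset (Fin n) → k) (he : ∀ F : Face p c, e F.1 = f F) (G : Face q c) :
    (((dualizing k n).d p q).app c).hom f G =
      ∑ j ∈ G.1ᶜ, (isgn j (insert j G.1) : k) * e (insert j G.1) := by
  rw [dualizing_d_apply h, Finset.sum_subtype G.1ᶜ (fun j => Finset.mem_compl)]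
  refine Finset.sum_congr rfl fun j _ => ?_
  rw [sgn_eq_isgn]
  exact congrArg _ (he _).symm

/-- In degree `c` the complex is indexed by the sets containing `supp₊(c)`. A fixed `j ∉ supp₊(c)`
may be freely added or removed, and this contracts the complex. If there is no such `j`, the only
face is `[n]`, in position `-n`. -/
lemma dualizing_exact {p q r : ℤ} (hpq : p + 1 = q) (hqr : q + 1 = r) (hq : q ≠ -n) (c : Deg n)
    (f : Face q c → k) (hf : (((dualizing k n).d q r).app c).hom f = 0) :
    ∃ g : Face p c → k, (((dualizing k n).d p q).app c).hom g = f := by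
  classical
  by_cases hc : ∃ j, j ∉ posSupp c
  · obtain ⟨j, hj⟩ := hc
    let e : Finset (Fin n) → k := fun F =>
      if h : (F.card : ℤ) = -q ∧ posSupp c ⊆ F then f ⟨F, h⟩ else 0
    have he : ∀ F : Face q c, e F.1 = f F := fun F => dif_pos F.2
    let e' : Finset (Fin n) → k := fun F =>
      if j ∈ F then (isgn j F : k) * e (F.erase j) else 0
    refine ⟨fun F => e' F.1, ?_⟩
    funext G
    rw [dualizing_d_apply' hpq c _ e' (fun _ => rfl)]
    by_cases hG : j ∈ G.1
    · set K := G.1.erase j with hK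
      have hGK : insert j K = G.1 := Finset.insert_erase hG
      have hjK : j ∉ K := Finset.notMem_erase j G.1
      have hKf : (K.card : ℤ) = -r ∧ posSupp c ⊆ K := by
        have h1 := Finset.card_erase_add_one hG
        have h2 := G.2.1
        refine ⟨by lia, fun i hi => Finset.mem_erase.2 ⟨?_, G.2.2 hi⟩⟩
        rintro rfl
        exact hj hi
      have hKd : ∑ l ∈ Kᶜ, (isgn l (insert l K) : k) * e (insert l K) = 0 :=
        (dualizing_d_apply' hqr c f e he ⟨K, hKf⟩).symm.trans (congrFun hf _)
      have hKc : Kᶜ = insert j G.1ᶜ := by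
        ext i
        simp only [hK, Finset.mem_compl, Finset.mem_erase, Finset.mem_insert]
        tauto
      rw [hKc, Finset.sum_insert (by simpa using hG), hGK, he] at hKd
      have hs : ∀ l ∈ G.1ᶜ, (isgn l (insert l G.1) : k) * e' (insert l G.1) =
          -(isgn j G.1 : k) * ((isgn l (insert l K) : k) * e (insert l K)) := by
        intro l hl
        have hl' : l ∉ G.1 := Finset.mem_compl.1 hl
        have hjl : j ≠ l := fun h => hl' (h ▸ hG)
        have hlK : l ∉ K := fun h => hl' (Finset.mem_of_mem_erase h)
        have h1 := isgn_insert_mul_add (j := j) (l := l) (F := insert l K)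
          (by simp [hjl, hjK]) (by simp)
        rw [Finset.erase_insert hlK, Finset.insert_comm, hGK] at h1
        have h2 : isgn j (insert l G.1) = isgn j (insert l K) := by
          rw [← hGK, Finset.insert_comm, isgn_insert_self]
        have h3 : isgn j K = isgn j G.1 := by rw [hK, isgn_erase_self]
        have h4 : (insert l G.1).erase j = insert l K := by
          rw [Finset.erase_insert_of_ne hjl.symm]
        simp only [e', Finset.mem_insert, hG, or_true, if_true, h2, h4]
        rw [h3] at h1
        have h1' : (isgn j (insert l K) : k) * (isgn l (insert l G.1) : k) +
          (isgn l (insert l K) : k) * (isgn j G.1 : k) = 0 := by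
          exact_mod_cast congrArg (Int.cast (R := k)) h1
        linear_combination (e (insert l K)) * h1'
      rw [Finset.sum_congr rfl hs, ← Finset.mul_sum, eq_neg_of_add_eq_zero_right hKd]
      have h5 : (isgn j G.1 : k) * (isgn j G.1 : k) = 1 := by
        exact_mod_cast congrArg (Int.cast (R := k)) (isgn_mul_self j G.1)
      linear_combination (f G) * h5
    · rw [Finset.sum_eq_single_of_mem j (Finset.mem_compl.2 hG)]
      · simp only [e', Finset.mem_insert_self, if_true, Finset.erase_insert hG, he]
        have h5 : (isgn j (insert j G.1) : k) * (isgn j (insert j G.1) : k) = 1 := by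
          exact_mod_cast congrArg (Int.cast (R := k)) (isgn_mul_self j (insert j G.1))
        rw [← mul_assoc, h5, one_mul]
      · intro l _ hlj
        have : j ∉ insert l G.1 := by simp [hG, hlj.symm]
        simp only [e', this, if_false, mul_zero]
  · push Not at hc
    have hu : posSupp c = Finset.univ := Finset.eq_univ_iff_forall.2 hc
    have : IsEmpty (Face q c) := ⟨fun F => hq (by
      have h1 := F.2.1
      have h2 : F.1 = Finset.univ := by
        rw [← Finset.univ_subset_iff, ← hu]
        exact F.2.2
      rw [h2, Finset.card_univ, Fintype.card_fin] at h1
      lia)⟩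
    exact ⟨0, funext fun G => this.elim G⟩

end SquarefreeMod

namespace SquarefreeMod

variable {k : Type u} [Field k] {n : ℕ}

/-! ### Exactness in degrees -/

lemma exact_iff_app (S : ShortComplex (GrMod k n)) :
    S.Exact ↔ ∀ a (x : S.X₂.obj a), S.g.app a x = 0 → ∃ y, S.f.app a y = x := by
  rw [ShortComplex.exact_iff_isZero_homology, Functor.isZero_iff]
  refine forall_congr' fun a => ?_
  have e : (S.map ((evaluation _ _).obj a)).homology ≅ S.homology.obj a :=
    S.mapHomologyIso ((evaluation _ _).obj a)
  rw [← e.isZero_iff, ← ShortComplex.exact_iff_isZero_homology,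
    ShortComplex.moduleCat_exact_iff]
  rfl

/-! ### The dualizing complex as an injective resolution -/

/-- The augmentation `ω_S → ω^{-n}`. -/
def augment (q : ℤ) : canonical k n ⟶ (dualizing k n).X q where
  app c := ModuleCat.ofHom
    { toFun := fun x => (fun _ => x.1 : Face q c → k)
      map_add' := fun _ _ => rfl
      map_smul' := fun _ _ => rfl }
  naturality _ _ _ := rfl

/-- The scalar underlying a homogeneous element of `ω_S`. -/
def canonicalVal (c : Deg n) (x : (canonical k n).obj c) : k := x.1

lemma canonicalVal_injective (c : Deg n) : Function.Injective (canonicalVal (k := k) c) :=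
  fun _ _ h => Subtype.ext h

lemma canonicalVal_eq_zero {c : Deg n} {j : Fin n} (hj : j ∉ posSupp c)
    (x : (canonical k n).obj c) : canonicalVal c x = 0 :=
  x.2 fun h => hj (mem_posSupp.2 (by
    have h1 := Deg.le_def.1 h j
    have h2 : (0 : ℤ) ≤ -1 + c.coord j := h1
    lia))

lemma exists_canonicalVal {c : Deg n} (t : k) (ht : ∀ j, j ∉ posSupp c → t = 0) :
    ∃ x : (canonical k n).obj c, canonicalVal c x = t := by
  refine ⟨⟨t, fun h => ?_⟩, rfl⟩
  by_contra h0
  refine h (Deg.le_def.2 fun j => ?_)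
  have hj : 0 < c.coord j := mem_posSupp.1 (by_contra fun hj => h0 (ht j hj))
  change (0 : ℤ) ≤ -1 + c.coord j
  lia

lemma augment_apply (q : ℤ) (c : Deg n) (x : (canonical k n).obj c) (F : Face q c) :
    ((augment q).app c).hom x F = canonicalVal c x := rfl

lemma Face.eq_univ {q : ℤ} (hq : q = -n) {c : Deg n} (F : Face q c) : F.1 = Finset.univ := by
  rw [← Finset.card_eq_iff_eq_univ, Fintype.card_fin]
  have := F.2.1
  lia

/-- Each summand of the differential at `G` adds some `j ∉ G ⊇ supp₊(c)`, and then `ω_S` vanishes in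
degree `c`. -/
lemma augment_comp_d {q r : ℤ} (hqr : q + 1 = r) :
    augment q ≫ (dualizing k n).d q r = 0 := by
  ext c x
  funext G
  refine (dualizing_d_apply hqr c _ G).trans (Finset.sum_eq_zero fun j _ => ?_)
  have hj : j.1 ∉ posSupp c := fun h => j.2 (G.2.2 h)
  have h0 := canonicalVal_eq_zero hj x
  change _ * canonicalVal c x = 0
  rw [h0, mul_zero]

/-- The only face in position `-n` is `[n]`. If `j ∉ supp₊(c)`, then `[n] ∖ {j}` is a face of the
next term and the cocycle condition there reads `± f = 0`; otherwise the component of `ω_S` in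
degree `c` is all of `k`. -/
lemma augment_exact {q r : ℤ} (hq : q = -n) (hqr : q + 1 = r) (c : Deg n) (f : Face q c → k)
    (hf : (((dualizing k n).d q r).app c).hom f = 0) :
    ∃ x, ((augment q).app c).hom x = f := by
  let U : Face q c := ⟨Finset.univ, by rw [Finset.card_univ, Fintype.card_fin]; lia,
    Finset.subset_univ _⟩
  have hU : ∀ F, F = U := fun F => Subtype.ext (F.eq_univ hq)
  obtain ⟨x, hx⟩ := exists_canonicalVal (k := k) (c := c) (f U) fun j hj => by
    let G : Face r c := ⟨Finset.univ.erase j, by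
        have := Finset.card_erase_add_one (Finset.mem_univ j)
        rw [Finset.card_univ, Fintype.card_fin] at this
        lia, fun i hi => Finset.mem_erase.2 ⟨fun e => hj (e ▸ hi), Finset.mem_univ i⟩⟩
    have h2 : G.1ᶜ = {j} := by simp [G, Finset.compl_erase]
    have h1 : ∑ l ∈ G.1ᶜ, (isgn l (insert l G.1) : k) * f U = 0 :=
      (dualizing_d_apply' hqr c f (fun _ => f U) (fun F => by rw [hU F]) G).symm.trans
        (congrFun hf G)
    rw [h2, Finset.sum_singleton] at h1
    rcases mul_eq_zero.1 h1 with h3 | h3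
    · exfalso
      have h4 := congrArg (Int.cast (R := k)) (isgn_mul_self j (insert j G.1))
      rw [Int.cast_mul, h3, zero_mul, Int.cast_one] at h4
      exact zero_ne_one h4
    · exact h3
  refine ⟨x, funext fun F => ?_⟩
  rw [augment_apply, hx, hU F]

lemma augment_injective {q : ℤ} (hq : q = -n) (c : Deg n) :
    Function.Injective ((augment (k := k) q).app c).hom := fun x y h => by
  let U : Face q c := ⟨Finset.univ, by rw [Finset.card_univ, Fintype.card_fin]; lia,
    Finset.subset_univ _⟩
  exact canonicalVal_injective c (congrFun h U)

/-- The nonnegatively indexed complex `ω^{• - n}(a)`. -/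
def resCocomplex (k : Type u) [Field k] {n : ℕ} (a : Deg n) : CochainComplex (GrMod k n) ℕ where
  X j := ((shift k n).obj ((dualizing k n).X ((j : ℤ) - n))).obj a
  d i j := shiftD k a ((i : ℤ) - n) ((j : ℤ) - n)
  shape i j h := by
    have : (dualizing k n).d ((i : ℤ) - n) ((j : ℤ) - n) = 0 := by
      apply (dualizing k n).shape
      simp only [ComplexShape.up_Rel] at h ⊢
      lia
    simp only [shiftD]
    rw [this]
    rfl
  d_comp_d' i j l _ _ := by
    simp only [shiftD]
    rw [← NatTrans.comp_app, ← Functor.map_comp, HomologicalComplex.d_comp_d]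
    rfl

lemma resCocomplex_exactAt (a : Deg n) (j : ℕ) : (resCocomplex k a).ExactAt (j + 1) := by
  rw [HomologicalComplex.exactAt_iff' _ j (j + 1) (j + 2) (by simp) (by simp)]
  rw [exact_iff_app]
  intro b x hx
  exact dualizing_exact (p := (j : ℤ) - n) (q := ((j + 1 : ℕ) : ℤ) - n)
    (r := ((j + 2 : ℕ) : ℤ) - n) (by push_cast; ring) (by push_cast; ring)
    (by push_cast; lia) (a + b) x hx

/-- The augmentation of `ω^{• - n}(a)`. -/
def resAugment (k : Type u) [Field k] {n : ℕ} (a : Deg n) :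
    ((shift k n).obj (canonical k n)).obj a ⟶ (resCocomplex k a).X 0 :=
  ((shift k n).map (augment (((0 : ℕ) : ℤ) - n))).app a

lemma resAugment_comp_d (a : Deg n) : resAugment k a ≫ (resCocomplex k a).d 0 1 = 0 := by
  change ((shift k n).map (augment (((0 : ℕ) : ℤ) - n))).app a ≫
    ((shift k n).map ((dualizing k n).d _ _)).app a = 0
  rw [← NatTrans.comp_app, ← Functor.map_comp, augment_comp_d (by push_cast; ring)]
  rfl

lemma mono_resAugment (a : Deg n) : Mono (resAugment k a) := by
  rw [NatTrans.mono_iff_mono_app]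
  intro b
  rw [ModuleCat.mono_iff_injective]
  exact augment_injective (by simp) (a + b)

/-- The injective resolution of `ω_S(a)` given by the shifted dualizing complex. -/
def resolution (k : Type u) [Field k] {n : ℕ} (a : Deg n) :
    InjectiveResolution (((shift k n).obj (canonical k n)).obj a) where
  cocomplex := resCocomplex k a
  injective j := injective_shift_dualizing _ a
  ι := (CochainComplex.fromSingle₀Equiv _ _).symm ⟨resAugment k a, resAugment_comp_d a⟩
  quasiIso := ⟨fun j => by
    cases j
    · rw [CochainComplex.quasiIsoAt₀_iff, ShortComplex.quasiIso_iff_of_zeros]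
      · refine (ShortComplex.exact_and_mono_f_iff_of_iso
          (S₂ := ShortComplex.mk _ _ (resAugment_comp_d (k := k) a)) ?_).2 ⟨?_, mono_resAugment a⟩
        · exact ShortComplex.isoMk (Iso.refl _) (Iso.refl _) (Iso.refl _)
            ((Category.id_comp _).trans (Category.comp_id _).symm)
            ((Category.id_comp _).trans (Category.comp_id _).symm)
        · rw [exact_iff_app]
          intro b x hx
          exact augment_exact (by simp) (by push_cast; ring) (a + b) x hx
      · rfl
      · rfl
      · exact (resCocomplex k a).shape _ _ (by simp)
    · rw [quasiIsoAt_iff_exactAt]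
      · apply resCocomplex_exactAt
      · apply CochainComplex.exactAt_succ_single_obj⟩

lemma resolution_ι_f_zero (a : Deg n) : (resolution k a).ι.f 0 = resAugment k a := by
  simp [resolution]

/-- Multiplication `ω_S(a) → ω_S(b)` on the level of resolutions. -/
def resolutionHom (k : Type u) [Field k] {n : ℕ} {a b : Deg n} (h : a ⟶ b) :
    InjectiveResolution.Hom (resolution k a) (resolution k b)
      (((shift k n).obj (canonical k n)).map h) where
  hom :=
    { f := fun j => ((shift k n).obj ((dualizing k n).X ((j : ℤ) - n))).map h
      comm' := fun i j _ => (((shift k n).map ((dualizing k n).d _ _)).naturality h) }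
  ι_f_zero_comp_hom_f_zero := by
    rw [resolution_ι_f_zero, resolution_ι_f_zero]
    have := ((shift k n).map (augment (k := k) (((0 : ℕ) : ℤ) - n))).naturality h
    simp only [CochainComplex.single₀_map_f_zero]
    exact this.symm

end SquarefreeMod

namespace SquarefreeMod

open Abelian

variable {k : Type u} [Field k] {n : ℕ}

/-! ### `Ext` as the cohomology of the complex `Hom(M, ω^•)` -/

/-- The complex `Hom(M, ω^•)`. -/
def homComplex (M : GrMod k n) : CochainComplex (GrMod k n) ℤ :=
  ((grHom M).mapHomologicalComplex (ComplexShape.up ℤ)).obj (dualizing k n)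

/-- Elements of `Hom(M, ω^q)_a` as homomorphisms. -/
def homOf {M : GrMod k n} {q : ℤ} {a : Deg n} (x : ((homComplex M).X q).obj a) :
    M ⟶ ((shift k n).obj ((dualizing k n).X q)).obj a := x

/-- A class in position `0` can only be bounded by a map into position `-1`, where the resolution is
zero. -/
lemma extMk_zero_injective {M : GrMod k n} {a : Deg n}
    (f : M ⟶ (resolution k a).cocomplex.X 0)
    (hf : f ≫ (resolution k a).cocomplex.d 0 1 = 0)
    (h : (resolution k a).extMk f 1 rfl hf = 0) : f = 0 := by
  set R := resolution k a
  rw [← R.extEquivCohomologyClass.apply_eq_iff_eq,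
    InjectiveResolution.extEquivCohomologyClass_extMk,
    InjectiveResolution.extEquivCohomologyClass_zero,
    CochainComplex.HomComplex.CohomologyClass.mk_eq_zero_iff,
    CochainComplex.HomComplex.Cocycle.fromSingleMk_mem_coboundaries_iff _ _ _ _ _ (-1)
      (by simp)] at h
  obtain ⟨g, hg⟩ := h
  have hz : Limits.IsZero (R.cochainComplex.X (-1)) :=
    R.cochainComplex.isZero_of_isStrictlyGE 0 (-1) (by lia)
  rw [hz.eq_of_tgt g 0, Limits.zero_comp] at hg
  rw [← cancel_mono (R.cochainComplexXIso ((0 : ℕ) : ℤ) 0 rfl).inv, ← hg, Limits.zero_comp]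

lemma extMk_congr {M : GrMod k n} {a : Deg n} {j m : ℕ} {hm : j + 1 = m}
    {f g : M ⟶ (resolution k a).cocomplex.X j}
    (hf : f ≫ (resolution k a).cocomplex.d j m = 0)
    (hg : g ≫ (resolution k a).cocomplex.d j m = 0) (h : f = g) :
    (resolution k a).extMk f m hm hf = (resolution k a).extMk g m hm hg := by
  subst h
  rfl

lemma extMk_smul {M : GrMod k n} {a : Deg n} {j m : ℕ} (hm : j + 1 = m) (c : k)
    (f : M ⟶ (resolution k a).cocomplex.X j)
    (hf : f ≫ (resolution k a).cocomplex.d j m = 0) :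
    (resolution k a).extMk (c • f) m hm (by rw [Linear.smul_comp, hf, smul_zero]) =
      c • (resolution k a).extMk f m hm hf := by
  have h := (resolution k a).mk₀_comp_extMk f m hm hf (c • 𝟙 M)
  rw [Ext.mk₀_smul, Ext.smul_comp, Ext.mk₀_id_comp] at h
  rw [h]
  congr 1
  rw [Linear.smul_comp, Category.id_comp]

section Comparison

variable (M : GrMod k n) (j : ℕ)

/-- The strand of `Hom(M, ω^•)` computing `Ext^j(M, ω_S)`. -/
abbrev homStrand (p : ℤ) : ShortComplex (GrMod k n) :=
  (homComplex M).sc' p ((j : ℤ) - n) (((j + 1 : ℕ) : ℤ) - n)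

variable {M j}

/-- The homomorphism underlying a cycle. -/
def cycleHom {p : ℤ} {a : Deg n} (x : (homStrand M j p).cycles.obj a) :
    M ⟶ (resolution k a).cocomplex.X j :=
  homOf ((homStrand M j p).iCycles.app a x)

lemma cycleHom_comp_d {p : ℤ} {a : Deg n} (x : (homStrand M j p).cycles.obj a) :
    cycleHom x ≫ (resolution k a).cocomplex.d j (j + 1) = 0 := by
  have h := congrArg (fun f => f.app a x) (homStrand M j p).iCycles_g
  exact h

lemma cycleHom_injective {p : ℤ} {a : Deg n} :
    Function.Injective (cycleHom (M := M) (j := j) (p := p) (a := a)) := by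
  have : Mono ((homStrand M j p).iCycles.app a) := inferInstance
  exact (ModuleCat.mono_iff_injective _).1 this

lemma exists_cycleHom {p : ℤ} {a : Deg n} (f : M ⟶ (resolution k a).cocomplex.X j)
    (hf : f ≫ (resolution k a).cocomplex.d j (j + 1) = 0) :
    ∃ x : (homStrand M j p).cycles.obj a, cycleHom x = f := by
  have h := (exact_iff_app (ShortComplex.mk _ _ (homStrand M j p).iCycles_g)).1
    (ShortComplex.exact_of_f_is_kernel _ (homStrand M j p).cyclesIsKernel) a f hf
  exact h

variable (M j) in
/-- The map from cycles of `Hom(M, ω^•)` to `Ext`. -/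
def cyclesToExt (p : ℤ) : (homStrand M j p).cycles ⟶ grExt M (canonical k n) j where
  app a := ModuleCat.ofHom
    { toFun := fun x => (resolution k a).extMk (cycleHom x) (j + 1) rfl (cycleHom_comp_d x)
      map_add' := fun x y => by
        rw [InjectiveResolution.add_extMk]
        congr 1
        exact map_add ((homStrand M j p).iCycles.app a).hom x y
      map_smul' := fun c x => by
        rw [RingHom.id_apply, ← extMk_smul]
        congr 1
        exact map_smul ((homStrand M j p).iCycles.app a).hom c x }
  naturality a b h := by
    ext x
    have h1 := InjectiveResolution.extMk_comp_mk₀ (cycleHom x) (j + 1) rfl (cycleHom_comp_d x)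
      (resolutionHom k h)
    refine Eq.trans ?_ h1.symm
    exact extMk_congr (cycleHom_comp_d ((homStrand M j p).cycles.map h x)) _
      (NatTrans.naturality_apply (homStrand M j p).iCycles h x)

lemma epi_cyclesToExt (p : ℤ) : Epi (cyclesToExt M j p) := by
  rw [NatTrans.epi_iff_epi_app]
  intro a
  rw [ModuleCat.epi_iff_surjective]
  intro α
  obtain ⟨f, hf, rfl⟩ := (resolution k a).extMk_surjective α (j + 1) rfl
  obtain ⟨x, rfl⟩ := exists_cycleHom (p := p) f hf
  exact ⟨x, rfl⟩

lemma cycleHom_toCycles {p : ℤ} {a : Deg n} (g : ((homComplex M).X p).obj a) :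
    cycleHom ((homStrand M j p).toCycles.app a g) = homOf g ≫ shiftD k a p ((j : ℤ) - n) :=
  congrArg (fun f => f.app a g) (homStrand M j p).toCycles_i

/-- The coboundary criterion with the indexing of `ω^•`. For `j = 0` the preceding term is `ω^{-n-1}
= 0`, which the resolution indexed by `ℕ` does not contain, so that case is separate. -/
lemma extMk_eq_zero_iff_exists {p : ℤ} (hp : p + 1 = (j : ℤ) - n) {a : Deg n}
    (f : M ⟶ (resolution k a).cocomplex.X j)
    (hf : f ≫ (resolution k a).cocomplex.d j (j + 1) = 0) :
    (resolution k a).extMk f (j + 1) rfl hf = 0 ↔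
      ∃ g : M ⟶ ((shift k n).obj ((dualizing k n).X p)).obj a,
        g ≫ shiftD k a p ((j : ℤ) - n) = f := by
  rcases j with _ | i
  · constructor
    · intro h
      exact ⟨0, by rw [Limits.zero_comp]; exact (extMk_zero_injective f hf h).symm⟩
    · rintro ⟨g, rfl⟩
      have hg : g = 0 := hom_ext_homEval fun c F y =>
        (Face.isEmpty_of_lt (by push_cast at hp; lia) (a + c)).elim F
      subst hg
      exact (extMk_congr _ (by rw [Limits.zero_comp]) Limits.zero_comp).trans
        ((resolution k a).extMk_zero 1 rfl)
  · obtain rfl : p = (i : ℤ) - n := by push_cast at hp; lia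
    exact (resolution k a).extMk_eq_zero_iff f (i + 2) rfl hf i rfl

lemma toCycles_comp_cyclesToExt {p : ℤ} (hp : p + 1 = (j : ℤ) - n) :
    (homStrand M j p).toCycles ≫ cyclesToExt M j p = 0 := by
  ext a g
  exact (extMk_eq_zero_iff_exists hp _ (cycleHom_comp_d _)).2
    ⟨homOf g, (cycleHom_toCycles g).symm⟩

lemma exact_cyclesToExt {p : ℤ} (hp : p + 1 = (j : ℤ) - n) :
    (ShortComplex.mk _ _ (toCycles_comp_cyclesToExt (M := M) hp)).Exact := by
  rw [exact_iff_app]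
  intro a x hx
  obtain ⟨g, hg⟩ := (extMk_eq_zero_iff_exists hp _ (cycleHom_comp_d x)).1 hx
  exact ⟨g, cycleHom_injective ((cycleHom_toCycles g).trans hg)⟩

variable (M j) in
/-- The cohomology of `Hom(M, ω^•)` is `Ext(M, ω_S)`. -/
def homologyHomComplexIso : (homComplex M).homology ((j : ℤ) - n) ≅
    grExt M (canonical k n) j :=
  have hp : ((j : ℤ) - n - 1) + 1 = (j : ℤ) - n := by ring
  have := epi_cyclesToExt (M := M) (j := j) ((j : ℤ) - n - 1)
  let S := homStrand M j ((j : ℤ) - n - 1)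
  -- The map from cycles to `Ext` is surjective with the coboundaries as its kernel, so `Ext` itself
  -- serves as the homology object.
  let D : S.LeftHomologyData :=
    { K := S.cycles
      H := grExt M (canonical k n) j
      i := S.iCycles
      π := cyclesToExt M j _
      wi := S.iCycles_g
      hi := S.cyclesIsKernel
      wπ := toCycles_comp_cyclesToExt hp
      hπ := (exact_cyclesToExt hp).gIsCokernel }
  ShortComplex.homologyMapIso ((homComplex M).isoSc' _ _ _ (by simp) (by push_cast; simp; ring)) ≪≫
    D.homologyIso

end Comparison

end SquarefreeMod

namespace SquarefreeMod

variable {k : Type u} [Field k] {n : ℕ}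

/-! ### Exactness of the `ℕⁿ`-graded part and of Alexander duality -/

instance : (natPart k n).PreservesHomology :=
  Functor.preservesHomology_of_map_exact _ fun S hS => by
    rw [exact_iff_app] at hS ⊢
    intro a x hx
    obtain ⟨y, hy⟩ := hS a x.1 (congrArg Subtype.val hx)
    by_cases ha : 0 ≤ a
    · exact ⟨⟨y, fun h => absurd ha h⟩, Subtype.ext hy⟩
    · exact ⟨0, (map_zero ((S.map (natPart k n)).f.app a).hom).trans (Subtype.ext (x.2 ha).symm)⟩

instance : (straightDual k n).PreservesZeroMorphisms where
  map_zero _ _ := by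
    ext a φ
    apply LinearMap.ext
    intro x
    exact LinearMap.map_zero (show Module.Dual k _ from φ)

instance : (straightDual k n).PreservesHomology :=
  Functor.preservesHomology_of_map_exact _ fun S hS => by
    rw [← ShortComplex.exact_unop_iff, exact_iff_app] at hS
    rw [exact_iff_app]
    intro a φ hφ
    let ψ : Module.Dual k (S.X₂.unop.obj (sqfreeDeg (posSupp a)ᶜ)) := φ
    -- Over a field the image of a transpose is the annihilator of the kernel, and by exactness that
    -- kernel is the image of the other map.
    have h : ψ ∈ LinearMap.range (S.f.unop.app (sqfreeDeg (posSupp a)ᶜ)).hom.dualMap := by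
      rw [LinearMap.range_dualMap_eq_dualAnnihilator_ker, Submodule.mem_dualAnnihilator]
      intro y hy
      obtain ⟨w, rfl⟩ := hS _ y hy
      exact LinearMap.congr_fun (show (S.g.unop.app (sqfreeDeg (posSupp a)ᶜ)).hom.dualMap ψ = 0
        from hφ) w
    exact h

/-! ### Squarefreeness of the cohomology of `Hom(M, ω^•)` -/

lemma IsSquarefree.of_iso {X Y : GrMod k n} (hX : IsSquarefree X) (e : X ≅ Y) :
    IsSquarefree Y where
  subsingleton a ha := by
    have := hX.subsingleton a ha
    exact (e.app a).toLinearEquiv.symm.toEquiv.subsingleton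
  finite a ha := by
    have := hX.finite a ha
    exact Module.Finite.equiv (e.app a).toLinearEquiv
  bijective a b h ha hs := by
    have h1 : Y.map (homOfLE h) = e.inv.app a ≫ X.map (homOfLE h) ≫ e.hom.app b := by
      rw [e.hom.naturality, ← NatTrans.comp_app_assoc, e.inv_hom_id]
      exact (Category.id_comp _).symm
    have h2 : IsIso (X.map (homOfLE h)) :=
      (ConcreteCategory.isIso_iff_bijective _).2 (hX.bijective a b h ha hs)
    rw [h1]
    exact (ConcreteCategory.isIso_iff_bijective _).1 inferInstance

lemma subsingleton_homology_iff (S : ShortComplex (GrMod k n)) (a : Deg n) :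
    Subsingleton (S.homology.obj a) ↔
      ∀ x : S.X₂.obj a, S.g.app a x = 0 → ∃ y, S.f.app a y = x := by
  have e : (S.map ((evaluation _ _).obj a)).homology ≅ S.homology.obj a :=
    S.mapHomologyIso ((evaluation _ _).obj a)
  rw [← ModuleCat.isZero_iff_subsingleton, ← e.isZero_iff,
    ← ShortComplex.exact_iff_isZero_homology, ShortComplex.moduleCat_exact_iff]
  rfl

/-- The strand of `Hom(M, ω^•)` around cohomological degree `-i`. -/
abbrev dualStrand (M : GrMod k n) (i : ℤ) : ShortComplex (GrMod k n) :=
  (homComplex M).sc' (-(i + 1)) (-i) (-(i - 1))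

section Squarefree

variable {M : GrMod k n} (hM : IsSquarefree M)

lemma negPart_eq_zero {a : Deg n} (ha : 0 ≤ a) : negPart a = 0 := Deg.ext fun i => by
  have : (0 : ℤ) ≤ a.coord i := Deg.le_def.1 ha i
  rw [coord_negPart, Deg.coord_zero]
  lia

lemma isZero_homComplex_X {q : ℤ} (hq : ∀ c : Deg n, IsEmpty (Face q c)) :
    Limits.IsZero ((homComplex M).X q) := by
  rw [Functor.isZero_iff]
  intro a
  have : Subsingleton (((homComplex M).X q).obj a) := ⟨fun x y =>
    hom_ext_homEval (φ := homOf x) (ψ := homOf y) fun c F _ => (hq (a + c)).elim F⟩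
  exact ModuleCat.isZero_of_subsingleton _

lemma isZero_homology_of_isZero {S : ShortComplex (GrMod k n)} (h : Limits.IsZero S.X₂) :
    Limits.IsZero S.homology := by
  rw [← ShortComplex.exact_iff_isZero_homology]
  exact S.exact_of_isZero_X₂ h

lemma isZero_dualStrand_homology_of_neg {i : ℤ} (hi : i < 0) :
    Limits.IsZero (dualStrand M i).homology :=
  isZero_homology_of_isZero (isZero_homComplex_X (Face.isEmpty_of_pos (by lia)))

include hM

lemma subsingleton_dualStrand_homology_iff (a : Deg n) (i : ℕ) :
    Subsingleton ((dualStrand M i).homology.obj a) ↔ StrandExact M (negPart a) (posSupp a) i := by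
  rw [subsingleton_homology_iff, ← homExact_iff hM a (p := -((i : ℤ) + 1)) (q := -i)
    (r := -((i : ℤ) - 1)) (by ring) (by ring) rfl]
  rfl

/-- Evaluation at the corners embeds the component into the finite product of the duals of the
spaces `M_{a⁻ + F}`. -/
lemma finite_homComplex (q : ℤ) (a : Deg n) : Module.Finite k (((homComplex M).X q).obj a) := by
  have hfin : ∀ F : Finset (Fin n), Module.Finite k (M.obj (negPart a + sqfreeDeg F)) := fun F => by
    refine hM.finite _ (Deg.le_def.2 fun i => ?_)
    have h1 := Deg.le_def.1 (sqfreeDeg_nonneg F) i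
    rw [Deg.coord_zero] at h1 ⊢
    rw [Deg.coord_add, coord_negPart]
    lia
  let f : ((homComplex M).X q).obj a →ₗ[k]
      ∀ F : Finset (Fin n), Module.Dual k (M.obj (negPart a + sqfreeDeg F)) :=
    { toFun := fun x F => faceEval (homOf x) F
      map_add' := fun x y => by
        funext F
        by_cases hF : (F.card : ℤ) = -q ∧ posSupp a ⊆ F
        · rw [Pi.add_apply, faceEval_pos _ hF, faceEval_pos _ hF, faceEval_pos _ hF]
          rfl
        · rw [Pi.add_apply, faceEval_neg _ hF, faceEval_neg _ hF, faceEval_neg _ hF, add_zero]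
      map_smul' := fun c x => by
        funext F
        by_cases hF : (F.card : ℤ) = -q ∧ posSupp a ⊆ F
        · rw [Pi.smul_apply, faceEval_pos _ hF, faceEval_pos _ hF]
          rfl
        · rw [Pi.smul_apply, faceEval_neg _ hF, faceEval_neg _ hF, smul_zero] }
  exact Module.Finite.of_injective f fun x y h => hom_ext_faceEval hM fun F _ => congrFun h F

/-- For nonnegative degrees the squarefree degree of `F` is a corner, whatever the degree. Degrees
with equal positive support have the same faces, so homomorphisms into both shifts are determined by
the same data. -/
lemma bijective_homComplex_map (q : ℤ) {a b : Deg n} (h : a ≤ b) (ha : 0 ≤ a)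
    (hs : posSupp b = posSupp a) :
    Function.Bijective (((homComplex M).X q).map (homOfLE h)) := by
  have hc : ∀ {c : Deg n}, 0 ≤ c → ∀ F : Face q c, IsCorner c F.1 (sqfreeDeg F.1) :=
    fun {c} h0 F i => by
      rw [coord_sqfreeDeg]
      refine ⟨fun hi => by rw [if_pos hi], fun hi => ?_⟩
      have h1 : ¬ 0 < c.coord i := fun h' => hi (F.2.2 (mem_posSupp.2 h'))
      have h2 : (0 : ℤ) ≤ c.coord i := Deg.le_def.1 h0 i
      rw [if_neg hi]
      lia
  have hb : 0 ≤ b := ha.trans h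
  constructor
  · intro x y hxy
    refine hom_ext_corner hM (φ := homOf x) (ψ := homOf y) (fun F => sqfreeDeg F.1) (hc ha)
      fun F y' => ?_
    let G : Face q b := ⟨F.1, F.2.1, hs.subset.trans F.2.2⟩
    exact congrArg (fun z => homEval (homOf z) (sqfreeDeg F.1)
      ⟨F.1, F.2.1, (hc hb G).posSupp_subset⟩ y') hxy
  · intro y
    obtain ⟨φ, hφ⟩ := exists_hom_corner hM (fun F : Face q a => sqfreeDeg F.1) (hc ha)
      fun F => homEval (homOf y) (sqfreeDeg F.1)
        ⟨F.1, F.2.1, (hc hb (⟨F.1, F.2.1, hs.subset.trans F.2.2⟩ : Face q b)).posSupp_subset⟩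
    refine ⟨φ, hom_ext_corner hM (ψ := homOf y) (fun F => sqfreeDeg F.1) (hc hb) fun F y' => ?_⟩
    exact hφ ⟨F.1, F.2.1, hs.symm.subset.trans F.2.2⟩ y'

lemma isSquarefree_dualStrand_homology (i : ℤ) : IsSquarefree (dualStrand M i).homology where
  subsingleton a ha := by
    rcases lt_or_ge i 0 with hi | hi
    · exact ModuleCat.subsingleton_of_isZero
        ((Functor.isZero_iff _).1 (isZero_dualStrand_homology_of_neg hi) a)
    · lift i to ℕ using hi
      rw [subsingleton_dualStrand_homology_iff hM]
      obtain ⟨j, hj⟩ : ∃ j, a.coord j < 0 := by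
        by_contra! h
        exact ha (Deg.le_def.2 h)
      -- A coordinate `a_j < 0` makes `a⁻` positive at `j`, and `j ∉ supp₊(a)`. The terms of `Hom(M,
      -- ω^•)_a` need not vanish, but the strand is contractible.
      refine strandExact_of_pos hM (j := j) ?_ ?_ i
      · rw [coord_negPart]
        lia
      · rw [mem_posSupp]
        lia
  finite a _ := by
    have h2 : Module.Finite k ((dualStrand M i).X₂.obj a) := finite_homComplex hM (-i) a
    have h3 : Module.Finite k ((dualStrand M i).cycles.obj a) :=
      Module.Finite.of_injective ((dualStrand M i).iCycles.app a).hom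
        ((ModuleCat.mono_iff_injective _).1 inferInstance)
    exact Module.Finite.of_surjective ((dualStrand M i).homologyπ.app a).hom
        ((ModuleCat.epi_iff_surjective _).1 inferInstance)
  bijective a b h ha hs := by
    have hX : ∀ q, IsIso (((homComplex M).X q).map (homOfLE h)) := fun q =>
      (ConcreteCategory.isIso_iff_bijective _).2 (bijective_homComplex_map hM q h ha hs)
    -- Multiplication is a natural transformation between the exact evaluation functors, so
    -- bijectivity on the three terms passes to homology.
    let τ := (evaluation (Deg n) (ModuleCat.{u} k)).map (homOfLE h)
    have h1 : IsIso ((dualStrand M i).mapNatTrans τ).τ₁ := hX _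
    have h2 : IsIso ((dualStrand M i).mapNatTrans τ).τ₂ := hX _
    have h3 : IsIso ((dualStrand M i).mapNatTrans τ).τ₃ := hX _
    have h4 : IsIso ((dualStrand M i).mapNatTrans τ) := ShortComplex.isIso_of_isIso _
    have h5 : IsIso (τ.app (dualStrand M i).homology) := by
      rw [NatTrans.app_homology]
      infer_instance
    exact (ConcreteCategory.isIso_iff_bijective _).1 h5

omit hM

variable (M) in
lemma nonempty_dualStrandIso (i : ℤ) :
    Nonempty ((dualStrand M i).homology ≅ grExtInt M (canonical k n) (n - i)) := by
  rcases le_or_gt i n with hi | hi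
  · obtain ⟨j, hj⟩ : ∃ j : ℕ, (n : ℤ) - i = j := ⟨(n - i).toNat, by lia⟩
    obtain rfl : i = n - j := by lia
    rw [hj]
    have e : (homComplex M).homology ((j : ℤ) - n) ≅ grExt M (canonical k n) j :=
      homologyHomComplexIso M j
    have hq : -((n : ℤ) - j) = j - n := by ring
    rw [← hq] at e
    exact ⟨(ShortComplex.homologyMapIso ((homComplex M).isoSc' (-(((n : ℤ) - j) + 1))
      (-((n : ℤ) - j)) (-(((n : ℤ) - j) - 1)) (by simp; ring) (by simp; ring))).symm ≪≫ e⟩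
  · obtain ⟨j, hj⟩ : ∃ j : ℕ, (n : ℤ) - i = Int.negSucc j :=
      ⟨(i - n - 1).toNat, by rw [Int.negSucc_eq]; lia⟩
    rw [hj]
    -- For `i > n` both sides vanish: no `F ⊆ [n]` has `i` elements.
    refine ⟨(isZero_homology_of_isZero
      (isZero_homComplex_X (Face.isEmpty_of_lt (by lia)))).iso ?_⟩
    rw [Functor.isZero_iff]
    intro a
    exact ModuleCat.isZero_of_subsingleton (ModuleCat.of k PUnit)

/-! ### The cohomology of `𝐀 ∘ 𝐃` -/

/-- The `ℕⁿ`-graded part of an `ℕⁿ`-graded module is the module itself. -/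
def natPartIso {X : GrMod k n} (hX : ∀ a : Deg n, ¬ 0 ≤ a → Subsingleton (X.obj a)) :
    (natPart k n).obj X ≅ X :=
  NatIso.ofComponents (fun a => (LinearEquiv.ofBijective (natPartAt X a).subtype
    ⟨Subtype.val_injective, fun x => ⟨⟨x, fun h => (hX a h).elim x 0⟩, rfl⟩⟩).toModuleIso)
    fun _ => rfl

/-- The cohomology of `𝐀 ∘ 𝐃 (M)` as the Alexander dual of a graded part. -/
def complexFHomologyIso (M : GrMod k n) (i : ℤ) : (complexF M).homology i ≅
    (alexander k n).obj (.op ((natPart k n).obj (dualStrand M i).homology)) :=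
  let S := (dualStrand M i).map (natPart k n)
  -- The two short complexes agree by definition, since `𝐀` is `straightDual` followed by `𝒩` and
  -- reverses the indices. Exactness then moves homology through the functors one at a time.
  let e : (S.op.map (straightDual k n)).map (natPart k n) ≅
      (complexF M).sc' (i - 1) i (i + 1) := Iso.refl _
  ShortComplex.homologyMapIso ((complexF M).isoSc' (i - 1) i (i + 1) (by simp) (by simp) ≪≫
    e.symm) ≪≫ ShortComplex.mapHomologyIso _ (natPart k n) ≪≫
    (natPart k n).mapIso (S.op.mapHomologyIso (straightDual k n) ≪≫
      (straightDual k n).mapIso (S.homologyOpIso ≪≫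
        ((dualStrand M i).mapHomologyIso (natPart k n)).symm.op))

include hM

/-- The inner `𝒩` can be dropped because the cohomology, being squarefree, already lives in
nonnegative degrees. -/
lemma nonempty_complexFIso (i : ℤ) : Nonempty ((complexF M).homology i ≅
    (alexander k n).obj (.op (dualStrand M i).homology)) :=
  ⟨complexFHomologyIso M i ≪≫ (alexander k n).mapIso
    (natPartIso (isSquarefree_dualStrand_homology hM i).subsingleton).symm.op⟩

/-- The nonzero components of an Alexander dual are duals of squarefree components, and each such
component occurs through its complement. -/
lemma isZero_complexF_homology_iff (i : ℤ) : Limits.IsZero ((complexF M).homology i) ↔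
    ∀ F, Subsingleton ((dualStrand M i).homology.obj (sqfreeDeg F)) := by
  obtain ⟨e⟩ := nonempty_complexFIso hM i
  rw [e.isZero_iff, Functor.isZero_iff]
  constructor
  · intro h F
    have hs := ModuleCat.subsingleton_of_isZero (h (sqfreeDeg Fᶜ))
    have h1 : Subsingleton (Module.Dual k
        ((dualStrand M i).homology.obj (sqfreeDeg (posSupp (sqfreeDeg Fᶜ))ᶜ))) :=
      ⟨fun x y => congrArg Subtype.val (hs.elim
        ⟨x, fun h => absurd (sqfreeDeg_nonneg _) h⟩ ⟨y, fun h => absurd (sqfreeDeg_nonneg _) h⟩)⟩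
    rw [Module.subsingleton_dual_iff, posSupp_sqfreeDeg, compl_compl] at h1
    exact h1
  · intro h a
    have h1 := h (posSupp a)ᶜ
    have h2 : Subsingleton (Module.Dual k
        ((dualStrand M i).homology.obj (sqfreeDeg (posSupp a)ᶜ))) :=
      (Module.subsingleton_dual_iff k).2 h1
    have h3 : Subsingleton (((alexander k n).obj (.op (dualStrand M i).homology)).obj a) :=
      ⟨fun x y => Subtype.ext (h2.elim x.1 y.1)⟩
    exact ModuleCat.isZero_of_subsingleton _

/-- A squarefree degree has negative part `0`, so the degree `A` component of the cohomology is
governed by the degree `0` strand over `A`. -/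
lemma isZero_complexF_homology_iff_strandExact (i : ℕ) :
    Limits.IsZero ((complexF M).homology i) ↔ ∀ A, StrandExact M 0 A i := by
  rw [isZero_complexF_homology_iff hM]
  refine forall_congr' fun F => ?_
  rw [subsingleton_dualStrand_homology_iff hM, negPart_eq_zero (sqfreeDeg_nonneg F),
    posSupp_sqfreeDeg]

end Squarefree

end SquarefreeMod

end

theorem corollary3p6 {k : Type u} [Field k] (n : ℕ) (M : GrMod k n) (hM : IsSquarefree M) :
    (∀ i : ℤ,
      IsSquarefree (grExtInt M (canonical k n) (n - i)) ∧
      Nonempty ((complexF M).homology i ≅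
        (alexander k n).obj (.op (grExtInt M (canonical k n) (n - i))))) ∧
    (∀ d : ℕ,
      (∀ i : ℤ, i ≠ d → Limits.IsZero ((complexF M).homology i)) ↔
        (IsCohenMacaulayOfDim M d ∨ Limits.IsZero M)) := by
  refine ⟨fun i => ?_, fun d => ?_⟩
  · obtain ⟨e⟩ := nonempty_dualStrandIso M i
    obtain ⟨e'⟩ := nonempty_complexFIso hM i
    exact ⟨(isSquarefree_dualStrand_homology hM i).of_iso e,
      ⟨e' ≪≫ (alexander k n).mapIso e.symm.op⟩⟩
  · rw [isCohenMacaulayOfDim_iff hM]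
    constructor
    · intro h i hi
      exact (isZero_complexF_homology_iff_strandExact hM i).1 (h i (by exact_mod_cast hi))
    · intro h i hi
      -- Strands have positions in `ℕ` only; for `i < 0` the term `ω^{-i}` is zero.
      rcases lt_or_ge i 0 with h0 | h0
      · refine (isZero_complexF_homology_iff hM i).2 fun F => ?_
        exact ModuleCat.subsingleton_of_isZero
          ((Functor.isZero_iff _).1 (isZero_dualStrand_homology_of_neg h0) _)
      · lift i to ℕ using h0
        exact (isZero_complexF_homology_iff_strandExact hM i).2 (h i (by exact_mod_cast hi))
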